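/- Notation. Let $\mathbb R^{4,1}$ be $\mathbb R^5$ with $\langle x,y\rangle = x_1y_1+\dots+x_4y_4-x_5y_5$, let $H^4=\{x:\langle x,x\rangle=-1,\ x_5>0\}$, let $\mathrm{SO}^+(4,1)$ be the group of real $5\times5$ matrices of determinant $1$ that preserve $\langle\cdot,\cdot\rangle$ and $H^4$, and let $e_1,\dots,e_5$ be the standard basis. Let $\mathbb H$ be the quaternions, $J=\mathrm{diag}(1,-1)$ and $\mathrm{SU}(1,1;\mathbb H)=\{A\in\mathbb H(2):A^*JA=J\}$. Let $E_1,\dots,E_4=\begin{pmatrix}0&u\\-\bar u&0\end{pmatrix}$ with $u=1,\mathbf i,\mathbf j,\mathbf k$, and $E_5=-J$. The double covering $\eta:\mathrm{SU}(1,1;\mathbb H)\to\mathrm{SO}^+(4,1)$ is defined by $\eta(A)=(m_{ij})$, $AE_jA^{-1}=\sum_i m_{ij}E_i$. Let $\mathrm{Spin}(4)=\eta^{-1}(\mathrm{SO}(4))$, where $\mathrm{SO}(4)$ is the stabilizer of $e_5$. Let $\Psi_2:\mathbb H(2)\to\mathbb C(4)$ replace each quaternion entry $a+b\,\mathbf j$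 ($a,b\in\mathbb C$) by the block $\begin{pmatrix}a&b\\-\bar b&\bar a\end{pmatrix}$, and let $\Delta_4^{\pm}$ be the restrictions of the representation $\Psi_2|_{\mathrm{Spin}(4)}$ on $\mathbb C^4$ to the $\pm1$-eigenspaces of $\mathbf i^2\Psi_2(E_1E_2E_3E_4)$ (the positive and negative complex spin representations). Let $\Gamma$ be a discrete torsion-free subgroup of $\mathrm{SO}^+(4,1)$ such that $M=\Gamma\backslash H^4$ is compact, and let $\hat\Gamma$ be a discrete subgroup of $\mathrm{SU}(1,1;\mathbb H)$ that $\eta$ maps isomorphically onto $\Gamma$, so that $\hat\Gamma\backslash\mathrm{SU}(1,1;\mathbb H)$ is a spin structure on $M$, a principal $\mathrm{Spin}(4)$-bundle with projection $\hat\Gamma\hat g\mapsto\Gamma\eta(\hat g)e_5$ that covers the oriented orthonormal frame bundle $\Gamma\backslash\mathrm{SO}^+(4,1)$ of $M$ by $\hat\Gamma\hat g\mapsto\Gamma\eta(\hat g)$. Let $\phi$ be an orientation-preserving isometry of $M$, and let $\hat\phi$ be a lift of $\phi$ to a symmetry of this spin structure, that is, an automorphism of the principal $\mathrm{Spin}(4)$-bundle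 $\hat\Gamma\backslash\mathrm{SU}(1,1;\mathbb H)$ that covers the action of $d\phi$ on the frame bundle. For $f$ in the normalizer of $\Gamma$ write $f_\star(\Gamma y)=\Gamma fy$, and for $\hat f$ in the normalizer of $\hat\Gamma$ write $\hat f_\star(\hat\Gamma\hat g)=\hat\Gamma\hat f\hat g$. Let $P$ be an isolated fixed point of $\phi$. Its contribution is $$\nu(\hat\phi,P)=\frac{\mathrm{tr}\,\Delta_4^+(s)-\mathrm{tr}\,\Delta_4^-(s)}{|\det(I-d\phi_P)|},$$ where $\hat\Gamma\hat g$ is a point of the spin structure over $P$ and $s\in\mathrm{Spin}(4)$ is defined by $\hat\phi(\hat\Gamma\hat g)=\hat\Gamma\hat g s$. **Theorem 7.5.** The number $\nu(\hat\phi,P)$ is well defined, independently of the choice of $\hat\Gamma\hat g$. Let $x=(x_1,\dots,x_5)\in H^4$ be such that $\Gamma x=P$. Then there is a unique $\Phi\in\mathrm{SO}^+(4,1)$ such that $\phi=\Phi_\star$ and $\Phi x=x$, and there is a unique $\hat\Phi\in\mathrm{SU}(1,1;\mathbb H)$ such that $\eta(\hat\Phi)=\Phi$ and $\hat\phi=\hat\Phi_\star$.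 Moreover $\mathrm{Re}(\hat\Phi_{11})\ne\mathrm{Re}(\hat\Phi_{22})$, and $$\nu(\hat\phi,P)=\frac{x_5}{2\,(\mathrm{Re}(\hat\Phi_{11})-\mathrm{Re}(\hat\Phi_{22}))}.$$ -/

import Mathlib

open scoped Quaternion Matrix Topology

namespace HypSpin

noncomputable section

/-! ## Hyperbolic 4-space and the positive special Lorentz group -/

/-- The Lorentzian inner product on `ℝ^{4,1}`; the time-like coordinate `x₅` is `x 4`. -/
def lor (x y : Fin 5 → ℝ) : ℝ :=
  x 0 * y 0 + x 1 * y 1 + x 2 * y 2 + x 3 * y 3 - x 4 * y 4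

/-- The hyperboloid model of hyperbolic 4-space. -/
def H4 : Type := {x : Fin 5 → ℝ // lor x x = -1 ∧ 0 < x 4}

instance : TopologicalSpace H4 :=
  inferInstanceAs (TopologicalSpace {x : Fin 5 → ℝ // lor x x = -1 ∧ 0 < x 4})

/-- The base point `e₅`. -/
def e5 : H4 := ⟨![0, 0, 0, 0, 1], by simp [lor], by simp⟩

lemma lor_neg_neg (x y : Fin 5 → ℝ) : lor (-x) (-y) = lor x y := by
  simp [lor]

/-- `SO⁺(4,1)`: the real `5 × 5` matrices of determinant one that preserve the Lorentzian inner
product and map the upper sheet `H⁴` of the hyperboloid to itself. -/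
def SO41 : Subgroup (Matrix.SpecialLinearGroup (Fin 5) ℝ) where
  carrier := {M | (∀ x y, lor (M.1 *ᵥ x) (M.1 *ᵥ y) = lor x y) ∧
    ∀ x, lor x x = -1 → 0 < x 4 → 0 < (M.1 *ᵥ x) 4}
  one_mem' := by
    constructor <;> intros <;> simp_all
  mul_mem' := by
    rintro M N ⟨hM, hM'⟩ ⟨hN, hN'⟩
    refine ⟨fun x y => ?_, fun x hx hx4 => ?_⟩
    · have := hM (N.1 *ᵥ x) (N.1 *ᵥ y)
      rw [Matrix.mulVec_mulVec, Matrix.mulVec_mulVec, hN] at this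
      simpa using this
    · have := hM' (N.1 *ᵥ x) (by rw [hN, hx]) (hN' x hx hx4)
      rw [Matrix.mulVec_mulVec] at this
      simpa using this
  inv_mem' := by
    rintro M ⟨hM, hM'⟩
    have key : ∀ x, M.1 *ᵥ ((M⁻¹).1 *ᵥ x) = x := fun x => by
      rw [Matrix.mulVec_mulVec, ← Matrix.SpecialLinearGroup.coe_mul, mul_inv_cancel]
      simp
    have hinv : ∀ x y, lor ((M⁻¹).1 *ᵥ x) ((M⁻¹).1 *ᵥ y) = lor x y := fun x y => by
      rw [← hM, key, key]
    refine ⟨hinv, fun x hx hx4 => ?_⟩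
    set y := (M⁻¹).1 *ᵥ x with hy
    have hyy : lor y y = -1 := by rw [hy, hinv, hx]
    by_contra hneg
    have hne : y 4 ≠ 0 := by
      intro h0
      simp only [lor, h0] at hyy
      nlinarith [sq_nonneg (y 0), sq_nonneg (y 1), sq_nonneg (y 2), sq_nonneg (y 3)]
    have hlt : y 4 < 0 := lt_of_le_of_ne (not_lt.mp hneg) hne
    have h := hM' (-y) (by rw [lor_neg_neg, hyy]) (by simpa using hlt)
    rw [Matrix.mulVec_neg, hy, key] at h
    simp only [Pi.neg_apply] at h
    linarith

/-- The underlying `5 × 5` matrix. -/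
def matR (M : SO41) : Matrix (Fin 5) (Fin 5) ℝ := M.1.1

lemma matR_mul (M N : SO41) : matR (M * N) = (matR M) * (matR N) := by
  simp [matR]

lemma matR_one : matR (1 : SO41) = 1 := by
  simp [matR]

/-- The action of `SO⁺(4,1)` on `H⁴` by matrix multiplication. -/
instance : MulAction SO41 H4 where
  smul M x := ⟨(matR M) *ᵥ x.1, (M.2.1 x.1 x.1).trans x.2.1, M.2.2 x.1 x.2.1 x.2.2⟩
  one_smul x := Subtype.ext (by
    change matR (1 : SO41) *ᵥ x.1 = x.1
    rw [matR_one, Matrix.one_mulVec])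
  mul_smul M N x := Subtype.ext (by
    change matR (M * N) *ᵥ x.1 = (matR M) *ᵥ ((matR N) *ᵥ x.1)
    rw [matR_mul, Matrix.mulVec_mulVec])

/-! ## The group `SU(1,1;ℍ)` and the double covering `η` -/

/-- `J = diag(1,-1)`. -/
def J : Matrix (Fin 2) (Fin 2) ℍ[ℝ] := !![1, 0; 0, -1]

/-- `SU(1,1;ℍ) = {A : A* J A = J}` (such an `A` is automatically invertible). -/
def SU11 : Subgroup (Matrix (Fin 2) (Fin 2) ℍ[ℝ])ˣ where
  carrier := {A | (A : Matrix (Fin 2) (Fin 2) ℍ[ℝ])ᴴ * J * (A : Matrix (Fin 2) (Fin 2) ℍ[ℝ]) = J}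
  one_mem' := by simp
  mul_mem' := by
    intro A B hA hB
    simp only [Set.mem_ofPred_eq, Units.val_mul, Matrix.conjTranspose_mul] at *
    calc _ = (B.1)ᴴ * ((A.1)ᴴ * J * A.1) * B.1 := by simp only [mul_assoc]
      _ = J := by rw [hA, hB]
  inv_mem' := by
    intro A hA
    simp only [Set.mem_ofPred_eq] at *
    have h1 : A.1 * (A⁻¹).1 = 1 := by simp
    have h2 : ((A⁻¹).1)ᴴ * (A.1)ᴴ = 1 := by
      rw [← Matrix.conjTranspose_mul, h1, Matrix.conjTranspose_one]
    calc ((A⁻¹).1)ᴴ * J * (A⁻¹).1 = ((A⁻¹).1)ᴴ * ((A.1)ᴴ * J * A.1) * (A⁻¹).1 := by rw [hA]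
      _ = (((A⁻¹).1)ᴴ * (A.1)ᴴ) * J * (A.1 * (A⁻¹).1) := by simp only [mul_assoc]
      _ = J := by rw [h1, h2]; simp

/-- The underlying quaternionic `2 × 2` matrix. -/
def matH (A : SU11) : Matrix (Fin 2) (Fin 2) ℍ[ℝ] := A.1.1

lemma matH_mul (A B : SU11) : matH (A * B) = (matH A) * (matH B) := by
  simp [matH]

lemma matH_one : matH (1 : SU11) = 1 := by
  simp [matH]

lemma matH_inv (A : SU11) : matH A⁻¹ = J * (matH A)ᴴ * J := by
  have h : (matH A)ᴴ * J * (matH A) = J := A.2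
  have hJ : J * J = 1 := by
    ext i j <;> fin_cases i <;> fin_cases j <;> simp [J, Matrix.mul_apply, Fin.sum_univ_two]
  have h1 : (matH A) * matH A⁻¹ = 1 := by rw [← matH_mul, mul_inv_cancel, matH_one]
  calc matH A⁻¹ = J * J * matH A⁻¹ := by rw [hJ, one_mul]
    _ = J * ((matH A)ᴴ * J * (matH A)) * matH A⁻¹ := by rw [h]
    _ = J * (matH A)ᴴ * J * ((matH A) * matH A⁻¹) := by simp only [mul_assoc]
    _ = J * (matH A)ᴴ * J := by rw [h1, mul_one]

/-- The real quaternion `a + b i + c j + d k`. -/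
def quat (a b c d : ℝ) : ℍ[ℝ] := ⟨a, b, c, d⟩

@[simp] lemma quat_re (a b c d : ℝ) : (quat a b c d).re = a := rfl
@[simp] lemma quat_imI (a b c d : ℝ) : (quat a b c d).imI = b := rfl
@[simp] lemma quat_imJ (a b c d : ℝ) : (quat a b c d).imJ = c := rfl
@[simp] lemma quat_imK (a b c d : ℝ) : (quat a b c d).imK = d := rfl

/-- The Clifford map `ℝ^{4,1} → ℍ(2)`.  Its values on the standard basis are
`E₁, …, E₄ = (0 u; -ū 0)` for `u = 1, i, j, k`, and `E₅ = -J`. -/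
def cliff (x : Fin 5 → ℝ) : Matrix (Fin 2) (Fin 2) ℍ[ℝ] :=
  !![quat (-x 4) 0 0 0, quat (x 0) (x 1) (x 2) (x 3);
    quat (-x 0) (x 1) (x 2) (x 3), quat (x 4) 0 0 0]

/-- The Clifford relations `c(x)² = -⟨x, x⟩`. -/
lemma cliff_sq (x : Fin 5 → ℝ) : cliff x * cliff x = (-lor x x) • 1 := by
  ext i j <;> fin_cases i <;> fin_cases j <;>
    simp [cliff, lor, Matrix.mul_apply, Fin.sum_univ_two] <;> ring

lemma cliff_add (x y : Fin 5 → ℝ) : cliff (x + y) = cliff x + cliff y := by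
  ext i j <;> fin_cases i <;> fin_cases j <;> simp [cliff] <;> ring

lemma cliff_smul (r : ℝ) (x : Fin 5 → ℝ) : cliff (r • x) = r • cliff x := by
  ext i j <;> fin_cases i <;> fin_cases j <;> simp [cliff]

lemma cliff_sub (x y : Fin 5 → ℝ) : cliff (x - y) = cliff x - cliff y := by
  ext i j <;> fin_cases i <;> fin_cases j <;> simp [cliff] <;> ring

/-- The coordinates of a matrix in the image of `cliff`. -/
def coord (X : Matrix (Fin 2) (Fin 2) ℍ[ℝ]) : Fin 5 → ℝ :=
  ![(X 0 1).re, (X 0 1).imI, (X 0 1).imJ, (X 0 1).imK, (X 1 1).re]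

lemma coord_cliff (x : Fin 5 → ℝ) : coord (cliff x) = x := by
  ext i; fin_cases i <;> simp [coord, cliff]

lemma dagger_eq (X : Matrix (Fin 2) (Fin 2) ℍ[ℝ]) :
    J * Xᴴ * J = !![star (X 0 0), -star (X 1 0); -star (X 0 1), star (X 1 1)] := by
  ext1 i j
  fin_cases i <;> fin_cases j <;>
    simp [J, Matrix.mul_apply, Fin.sum_univ_two, Matrix.vecMul, dotProduct]

/-- Characterization of the image of `cliff`. -/
lemma cliff_coord (X : Matrix (Fin 2) (Fin 2) ℍ[ℝ]) (h : J * Xᴴ * J = X)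
    (ht : (X 0 0).re + (X 1 1).re = 0) : cliff (coord X) = X := by
  rw [dagger_eq] at h
  have h00 := congrFun (congrFun h 0) 0
  have h01 := congrFun (congrFun h 0) 1
  have h11 := congrFun (congrFun h 1) 1
  simp [Quaternion.ext_iff] at h00 h01 h11
  ext i j <;> fin_cases i <;> fin_cases j <;>
    simp [cliff, coord] <;> linarith

lemma cliff_dagger (x : Fin 5 → ℝ) : J * (cliff x)ᴴ * J = cliff x := by
  rw [dagger_eq]
  ext i j <;> fin_cases i <;> fin_cases j <;> simp [cliff]

lemma J_sq : J * J = 1 := by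
  ext i j <;> fin_cases i <;> fin_cases j <;> simp [J, Matrix.mul_apply, Fin.sum_univ_two]

lemma J_star : Jᴴ = J := by
  ext i j <;> fin_cases i <;> fin_cases j <;> simp [J]

lemma re_trace_comm (X Y : Matrix (Fin 2) (Fin 2) ℍ[ℝ]) :
    (((X * Y) 0 0).re + ((X * Y) 1 1).re) = (((Y * X) 0 0).re + ((Y * X) 1 1).re) := by
  simp [Matrix.mul_apply, Fin.sum_univ_two]; ring

lemma matH_inv_mul (A : SU11) : matH A⁻¹ * matH A = 1 := by
  rw [← matH_mul, inv_mul_cancel, matH_one]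

/-- The vector representation: `c(A · x) = A c(x) A⁻¹`. -/
def etaVec (A : SU11) (x : Fin 5 → ℝ) : Fin 5 → ℝ :=
  coord (matH A * cliff x * matH A⁻¹)

lemma cliff_etaVec (A : SU11) (x : Fin 5 → ℝ) :
    cliff (etaVec A x) = matH A * cliff x * matH A⁻¹ := by
  apply cliff_coord
  · have h1 : (matH A⁻¹)ᴴ = J * matH A * J := by
      rw [matH_inv, Matrix.conjTranspose_mul, Matrix.conjTranspose_mul, J_star,
        Matrix.conjTranspose_conjTranspose, mul_assoc]
    rw [Matrix.conjTranspose_mul, Matrix.conjTranspose_mul, h1, matH_inv]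
    calc J * (J * matH A * J * ((cliff x)ᴴ * (matH A)ᴴ)) * J
        = (J * J) * matH A * (J * (cliff x)ᴴ) * 1 * (matH A)ᴴ * J := by
          simp only [mul_assoc, one_mul]
      _ = (J * J) * matH A * (J * (cliff x)ᴴ) * (J * J) * (matH A)ᴴ * J := by rw [J_sq]
      _ = (J * J) * matH A * (J * (cliff x)ᴴ * J) * (J * (matH A)ᴴ * J) := by
          simp only [mul_assoc]
      _ = _ := by rw [cliff_dagger, J_sq, one_mul]
  · rw [mul_assoc, re_trace_comm, mul_assoc, matH_inv_mul, mul_one]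
    simp [cliff]

lemma cliff_injective : Function.Injective cliff :=
  Function.LeftInverse.injective coord_cliff

/-- The vector representation as a linear map. -/
def etaLin (A : SU11) : (Fin 5 → ℝ) →ₗ[ℝ] (Fin 5 → ℝ) where
  toFun := etaVec A
  map_add' x y := cliff_injective (by
    simp only [cliff_add, cliff_etaVec, mul_add, add_mul])
  map_smul' r x := cliff_injective (by
    simp only [cliff_smul, cliff_etaVec, RingHom.id_apply, Matrix.mul_smul, Matrix.smul_mul])

lemma etaLin_mul (A B : SU11) : etaLin (A * B) = etaLin A ∘ₗ etaLin B := by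
  apply LinearMap.ext
  intro x
  apply cliff_injective
  change cliff (etaVec (A * B) x) = cliff (etaVec A (etaVec B x))
  rw [cliff_etaVec, cliff_etaVec, cliff_etaVec, mul_inv_rev, matH_mul, matH_mul]
  simp only [mul_assoc]

lemma etaLin_one : etaLin 1 = LinearMap.id := by
  apply LinearMap.ext
  intro x
  apply cliff_injective
  change cliff (etaVec 1 x) = cliff x
  rw [cliff_etaVec, inv_one, matH_one, one_mul, mul_one]

lemma lor_etaVec_self (A : SU11) (x : Fin 5 → ℝ) : lor (etaVec A x) (etaVec A x) = lor x x := by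
  have h := cliff_sq (etaVec A x)
  rw [cliff_etaVec] at h
  have h2 : matH A * cliff x * matH A⁻¹ * (matH A * cliff x * matH A⁻¹) = (-lor x x) • 1 := by
    calc _ = matH A * cliff x * (matH A⁻¹ * matH A) * cliff x * matH A⁻¹ := by
          simp only [mul_assoc]
      _ = matH A * (cliff x * cliff x) * matH A⁻¹ := by
          rw [matH_inv_mul, mul_one]; simp only [mul_assoc]
      _ = _ := by
          rw [cliff_sq, Matrix.mul_smul, Matrix.smul_mul, mul_one, ← matH_mul, mul_inv_cancel,
            matH_one]
  rw [h2] at h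
  have h3 := congrArg QuaternionAlgebra.re (congrFun (congrFun h 0) 0)
  simp at h3
  linarith

lemma lor_polar (x y : Fin 5 → ℝ) : 2 * lor x y = lor (x + y) (x + y) - lor x x - lor y y := by
  simp [lor]; ring

lemma lor_etaVec (A : SU11) (x y : Fin 5 → ℝ) : lor (etaVec A x) (etaVec A y) = lor x y := by
  have h := lor_polar (etaVec A x) (etaVec A y)
  have h2 : etaVec A x + etaVec A y = etaVec A (x + y) := ((etaLin A).map_add x y).symm
  rw [h2, lor_etaVec_self, lor_etaVec_self, lor_etaVec_self, ← lor_polar] at h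
  linarith

/-- The matrix of the vector representation: column `j` holds the coordinates of
`A E_j A⁻¹` with respect to `E₁, …, E₅`. -/
def etaMat (A : SU11) : Matrix (Fin 5) (Fin 5) ℝ := LinearMap.toMatrix' (etaLin A)

lemma etaMat_mul (A B : SU11) : etaMat (A * B) = etaMat A * etaMat B := by
  rw [etaMat, etaLin_mul, LinearMap.toMatrix'_comp]; rfl

lemma etaMat_one : etaMat 1 = 1 := by
  rw [etaMat, etaLin_one, LinearMap.toMatrix'_id]

lemma etaMat_mulVec (A : SU11) (x : Fin 5 → ℝ) : etaMat A *ᵥ x = etaVec A x :=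
  LinearMap.toMatrix'_mulVec (etaLin A) x

lemma lor_cs (x y : Fin 5 → ℝ) (hx : lor x x = -1) (hy : lor y y = -1) (hx4 : 0 < x 4)
    (h : lor x y < 0) : 0 < y 4 := by
  by_contra hneg
  push Not at hneg
  simp only [lor] at hx hy h
  have h1 : x 0 * y 0 + x 1 * y 1 + x 2 * y 2 + x 3 * y 3 < x 4 * y 4 := by linarith
  have h2 : x 4 * y 4 ≤ 0 := mul_nonpos_of_nonneg_of_nonpos hx4.le hneg
  have h3 : (x 4 * y 4) ^ 2 < (x 0 * y 0 + x 1 * y 1 + x 2 * y 2 + x 3 * y 3) ^ 2 := by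
    nlinarith
  have hx' : x 4 ^ 2 = 1 + (x 0 ^ 2 + x 1 ^ 2 + x 2 ^ 2 + x 3 ^ 2) := by linarith
  have hy' : y 4 ^ 2 = 1 + (y 0 ^ 2 + y 1 ^ 2 + y 2 ^ 2 + y 3 ^ 2) := by linarith
  rw [mul_pow, hx', hy'] at h3
  nlinarith [sq_nonneg (x 0 * y 1 - x 1 * y 0), sq_nonneg (x 0 * y 2 - x 2 * y 0),
    sq_nonneg (x 0 * y 3 - x 3 * y 0), sq_nonneg (x 1 * y 2 - x 2 * y 1),
    sq_nonneg (x 1 * y 3 - x 3 * y 1), sq_nonneg (x 2 * y 3 - x 3 * y 2),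
    sq_nonneg (x 0), sq_nonneg (x 1), sq_nonneg (x 2), sq_nonneg (x 3),
    sq_nonneg (y 0), sq_nonneg (y 1), sq_nonneg (y 2), sq_nonneg (y 3)]

lemma matH_inv_eq (A : SU11) :
    matH A⁻¹ = !![star (matH A 0 0), -star (matH A 1 0);
      -star (matH A 0 1), star (matH A 1 1)] := by
  rw [matH_inv, dagger_eq]

lemma etaVec_e5_four (A : SU11) : 0 ≤ etaVec A e5.1 4 := by
  have h : etaVec A e5.1 4 = (matH A 1 0).re ^ 2 + (matH A 1 0).imI ^ 2 + (matH A 1 0).imJ ^ 2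
      + (matH A 1 0).imK ^ 2 + (matH A 1 1).re ^ 2 + (matH A 1 1).imI ^ 2
      + (matH A 1 1).imJ ^ 2 + (matH A 1 1).imK ^ 2 := by
    simp [etaVec, coord, matH_inv_eq, cliff, e5, Matrix.mul_apply, Fin.sum_univ_two]
    ring
  rw [h]; positivity

lemma etaVec_pos (A : SU11) (x : Fin 5 → ℝ) (hx : lor x x = -1) (hx4 : 0 < x 4) :
    0 < etaVec A x 4 := by
  have he : lor (etaVec A e5.1) (etaVec A e5.1) = -1 := by rw [lor_etaVec, e5.2.1]
  have he4 : 0 < etaVec A e5.1 4 := by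
    refine lt_of_le_of_ne (etaVec_e5_four A) fun h0 => ?_
    simp only [lor, ← h0] at he
    nlinarith [sq_nonneg (etaVec A e5.1 0), sq_nonneg (etaVec A e5.1 1),
      sq_nonneg (etaVec A e5.1 2), sq_nonneg (etaVec A e5.1 3)]
  refine lor_cs _ _ he (by rw [lor_etaVec, hx]) he4 ?_
  rw [lor_etaVec]
  simpa [lor, e5] using hx4

lemma etaMat_det_sq (A : SU11) : (etaMat A).det * (etaMat A).det = 1 := by
  have h : (etaMat A)ᵀ * Matrix.diagonal (![1, 1, 1, 1, -1] : Fin 5 → ℝ) * etaMat A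
      = Matrix.diagonal (![1, 1, 1, 1, -1] : Fin 5 → ℝ) := by
    ext i j
    have h1 := lor_etaVec A (Pi.single i 1) (Pi.single j 1)
    rw [← etaMat_mulVec, ← etaMat_mulVec] at h1
    simp only [Matrix.mulVec_single_one, lor, Matrix.col_apply] at h1
    have h2 : ((etaMat A)ᵀ * Matrix.diagonal (![1, 1, 1, 1, -1] : Fin 5 → ℝ) * etaMat A :
          Matrix (Fin 5) (Fin 5) ℝ) i j
        = etaMat A 0 i * etaMat A 0 j + etaMat A 1 i * etaMat A 1 j
          + etaMat A 2 i * etaMat A 2 j + etaMat A 3 i * etaMat A 3 j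
          - etaMat A 4 i * etaMat A 4 j := by
      rw [Matrix.mul_apply, Fin.sum_univ_five]
      simp [Matrix.mul_diagonal]
      ring
    rw [h2, h1]
    fin_cases i <;> fin_cases j <;> simp
  have h3 := congrArg Matrix.det h
  simp [Matrix.det_mul, Fin.prod_univ_five] at h3
  exact h3

/-- An element of `SU(1,1;ℍ)` from a matrix with `X* J X = J`. -/
def mkSU (X : Matrix (Fin 2) (Fin 2) ℍ[ℝ]) (h : Xᴴ * J * X = J) : SU11 :=
  ⟨⟨X, J * Xᴴ * J, mul_eq_one_comm.mp (by
      rw [show J * Xᴴ * J * X = J * (Xᴴ * J * X) by simp only [mul_assoc], h, J_sq]), by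
      rw [show J * Xᴴ * J * X = J * (Xᴴ * J * X) by simp only [mul_assoc], h, J_sq]⟩, h⟩

lemma etaMat_det_of_sq (A : SU11) (B : SU11) (h : matH A = matH B * matH B) :
    (etaMat A).det = 1 := by
  have hA : A = B * B := Subtype.ext (Units.ext (by
    change matH A = matH (B * B)
    rw [h, matH_mul]))
  rw [hA, etaMat_mul, Matrix.det_mul, etaMat_det_sq]

lemma exists_unit_sqrt (p : ℍ[ℝ]) (hp : p * star p = 1) :
    ∃ r : ℍ[ℝ], star r * r = 1 ∧ p = r * r := by
  have hn : p.re ^ 2 + p.imI ^ 2 + p.imJ ^ 2 + p.imK ^ 2 = 1 := by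
    have := congrArg QuaternionAlgebra.re hp
    simp at this
    linarith
  by_cases h1 : p.re = -1
  · refine ⟨quat 0 1 0 0, ?_, ?_⟩
    · ext <;> simp
    · rw [h1] at hn
      have hi : p.imI = 0 := by nlinarith [sq_nonneg p.imI, sq_nonneg p.imJ, sq_nonneg p.imK]
      have hj : p.imJ = 0 := by nlinarith [sq_nonneg p.imI, sq_nonneg p.imJ, sq_nonneg p.imK]
      have hk : p.imK = 0 := by nlinarith [sq_nonneg p.imI, sq_nonneg p.imJ, sq_nonneg p.imK]
      ext <;> simp [h1, hi, hj, hk]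
  · have hpos : 0 < 2 + 2 * p.re := by
      have : -1 ≤ p.re := by
        nlinarith [sq_nonneg p.imI, sq_nonneg p.imJ, sq_nonneg p.imK]
      have := lt_of_le_of_ne this (Ne.symm h1)
      linarith
    set t := (√(2 + 2 * p.re))⁻¹ with ht
    have htt : t * t * (2 + 2 * p.re) = 1 := by
      have := Real.mul_self_sqrt hpos.le
      have h0 : √(2 + 2 * p.re) ≠ 0 := (Real.sqrt_pos.mpr hpos).ne'
      have h2 : t * √(2 + 2 * p.re) = 1 := inv_mul_cancel₀ h0
      rw [← this]
      linear_combination (t * √(2 + 2 * p.re) + 1) * h2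
    refine ⟨quat (t * (1 + p.re)) (t * p.imI) (t * p.imJ) (t * p.imK), ?_, ?_⟩
    · ext
      · simp
        linear_combination htt + (t * t) * hn
      all_goals (simp <;> ring)
    · ext
      · simp
        linear_combination (-p.re) * htt + (t * t) * hn
      · simp; linear_combination (-p.imI) * htt
      · simp; linear_combination (-p.imJ) * htt
      · simp; linear_combination (-p.imK) * htt

lemma diag_mem (p q : ℍ[ℝ]) (hp : star p * p = 1) (hq : star q * q = 1) :
    (!![p, 0; 0, q])ᴴ * J * !![p, 0; 0, q] = J := by
  ext1 i j
  fin_cases i <;> fin_cases j <;>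
    simp [J, Matrix.mul_apply, Fin.sum_univ_two, Matrix.vecMul, dotProduct, hp, hq]

lemma quat_unit_comm (p : ℍ[ℝ]) (hp : star p * p = 1) : p * star p = 1 := mul_eq_one_comm.mp hp

lemma etaMat_det_diag (A : SU11) (p q : ℍ[ℝ]) (hp : star p * p = 1) (hq : star q * q = 1)
    (h : matH A = !![p, 0; 0, q]) : (etaMat A).det = 1 := by
  obtain ⟨r, hr, rfl⟩ := exists_unit_sqrt p (quat_unit_comm p hp)
  obtain ⟨s, hs, rfl⟩ := exists_unit_sqrt q (quat_unit_comm q hq)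
  refine etaMat_det_of_sq A (mkSU _ (diag_mem r s hr hs)) ?_
  change matH A = !![r, 0; 0, s] * !![r, 0; 0, s]
  rw [h]
  ext1 i j
  fin_cases i <;> fin_cases j <;> simp [Matrix.mul_apply, Fin.sum_univ_two]

/-- Entries of elements of `SU(1,1;ℍ)`. -/
lemma entries (A : SU11) :
    Quaternion.normSq (matH A 0 0) - Quaternion.normSq (matH A 0 1) = 1 ∧
    Quaternion.normSq (matH A 1 1) - Quaternion.normSq (matH A 1 0) = 1 ∧
    Quaternion.normSq (matH A 0 0) - Quaternion.normSq (matH A 1 0) = 1 ∧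
    star (matH A 0 0) * matH A 0 1 = star (matH A 1 0) * matH A 1 1 := by
  have h1 : matH A * matH A⁻¹ = 1 := by rw [← matH_mul, mul_inv_cancel, matH_one]
  have h2 := matH_inv_mul A
  rw [matH_inv_eq] at h1 h2
  have a := congrArg QuaternionAlgebra.re (congrFun (congrFun h1 0) 0)
  have b := congrArg QuaternionAlgebra.re (congrFun (congrFun h1 1) 1)
  have c := congrArg QuaternionAlgebra.re (congrFun (congrFun h2 0) 0)
  have d := congrFun (congrFun h2 0) 1
  simp [Matrix.mul_apply, Fin.sum_univ_two] at a b c d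
  simp only [Quaternion.normSq_def']
  refine ⟨by linarith, by linarith, by linarith, ?_⟩
  exact add_neg_eq_zero.mp d

lemma exists_phase (a : ℍ[ℝ]) (ha : 1 ≤ Quaternion.normSq a) :
    ∃ p : ℍ[ℝ], star p * p = 1 ∧ ∃ t : ℝ, 0 < t ∧ a * p = quat t 0 0 0 := by
  set n := Quaternion.normSq a with hn
  have hpos : 0 < √n := Real.sqrt_pos.mpr (by linarith)
  have hsq : √n * √n = n := Real.mul_self_sqrt (by linarith)
  set u := (√n)⁻¹ with hu
  have huu : u * √n = 1 := by rw [hu]; exact inv_mul_cancel₀ hpos.ne'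
  have hun : u * u * n = 1 := by
    rw [← hsq]; linear_combination (u * √n + 1) * huu
  rw [Quaternion.normSq_def'] at hn
  have hut : u * n = √n := by linear_combination √n * huu - u * hsq
  refine ⟨quat (u * a.re) (-u * a.imI) (-u * a.imJ) (-u * a.imK), ?_, √n, hpos, ?_⟩
  · rw [hn] at hun
    ext
    · simp; linear_combination hun
    all_goals (simp <;> ring)
  · rw [hn] at hut
    ext
    · simp; rw [hn]; linear_combination hut
    all_goals (simp <;> ring)

lemma etaMat_det_boost (A : SU11) (s t : ℝ) (hs : 0 < s) (ht : 0 < t)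
    (h0 : matH A 0 0 = quat s 0 0 0) (h1 : matH A 1 1 = quat t 0 0 0) :
    (etaMat A).det = 1 := by
  obtain ⟨e1, e2, e3, e4⟩ := entries A
  set b := matH A 0 1 with hb
  set c := matH A 1 0 with hc
  rw [h0] at e1 e3 e4
  rw [h1] at e2 e4
  simp only [Quaternion.normSq_def', quat_re, quat_imI, quat_imJ, quat_imK] at e1 e2 e3
  have hst : s = t := by nlinarith
  subst hst
  simp [Quaternion.ext_iff] at e4
  obtain ⟨f0, f1, f2, f3⟩ := e4
  have g0 : c.re = b.re := mul_left_cancel₀ hs.ne' (by linarith)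
  have g1 : c.imI = -b.imI := mul_left_cancel₀ hs.ne' (by linarith)
  have g2 : c.imJ = -b.imJ := mul_left_cancel₀ hs.ne' (by linarith)
  have g3 : c.imK = -b.imK := mul_left_cancel₀ hs.ne' (by linarith)
  set β := √((s + 1) / 2) with hβ
  have hβpos : 0 < β := Real.sqrt_pos.mpr (by linarith)
  have hββ : β * β = (s + 1) / 2 := Real.mul_self_sqrt (by linarith)
  set k := (2 * β)⁻¹ with hk
  have hkβ : 2 * β * k = 1 := mul_inv_cancel₀ (by positivity)
  have hkk : k * k * (2 * (s + 1)) = 1 := by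
    have : k * k * (4 * (β * β)) = 1 := by linear_combination (2 * β * k + 1) * hkβ
    rw [hββ] at this; linear_combination this
  have hbb : k * k * (b.re ^ 2 + b.imI ^ 2 + b.imJ ^ 2 + b.imK ^ 2) = (s - 1) / 2 := by
    have : b.re ^ 2 + b.imI ^ 2 + b.imJ ^ 2 + b.imK ^ 2 = 2 * (s + 1) * ((s - 1) / 2) := by
      linarith
    rw [this]; linear_combination ((s - 1) / 2) * hkk
  have hmem : (!![quat β 0 0 0, quat (k * b.re) (k * b.imI) (k * b.imJ) (k * b.imK);
      quat (k * b.re) (-(k * b.imI)) (-(k * b.imJ)) (-(k * b.imK)), quat β 0 0 0])ᴴ * J *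
      !![quat β 0 0 0, quat (k * b.re) (k * b.imI) (k * b.imJ) (k * b.imK);
      quat (k * b.re) (-(k * b.imI)) (-(k * b.imJ)) (-(k * b.imK)), quat β 0 0 0] = J := by
    have hm : β * β - k * k * (b.re ^ 2 + b.imI ^ 2 + b.imJ ^ 2 + b.imK ^ 2) = 1 := by
      rw [hbb, hββ]; ring
    ext i j <;> fin_cases i <;> fin_cases j <;>
      simp [J, Matrix.mul_apply, Fin.sum_univ_two, Matrix.vecMul, dotProduct] <;>
      first | ring1 | linear_combination hm | linear_combination -hm
  refine etaMat_det_of_sq A (mkSU _ hmem) ?_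
  change matH A = !![quat β 0 0 0, quat (k * b.re) (k * b.imI) (k * b.imJ) (k * b.imK);
      quat (k * b.re) (-(k * b.imI)) (-(k * b.imJ)) (-(k * b.imK)), quat β 0 0 0] *
    !![quat β 0 0 0, quat (k * b.re) (k * b.imI) (k * b.imJ) (k * b.imK);
      quat (k * b.re) (-(k * b.imI)) (-(k * b.imJ)) (-(k * b.imK)), quat β 0 0 0]
  have hm : β * β + k * k * (b.re ^ 2 + b.imI ^ 2 + b.imJ ^ 2 + b.imK ^ 2) = s := by
    rw [hbb, hββ]; ring
  ext i j <;> fin_cases i <;> fin_cases j <;>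
    simp [Matrix.mul_apply, Fin.sum_univ_two, h0, h1, ← hb, ← hc, g0, g1, g2, g3] <;>
    first
      | ring1
      | linear_combination -hm
      | linear_combination b.re * hkβ
      | linear_combination -b.re * hkβ
      | linear_combination -b.imI * hkβ
      | linear_combination -b.imJ * hkβ
      | linear_combination -b.imK * hkβ
      | linear_combination b.imI * hkβ
      | linear_combination b.imJ * hkβ
      | linear_combination b.imK * hkβ

lemma etaMat_det (A : SU11) : (etaMat A).det = 1 := by
  obtain ⟨e1, e2, -, -⟩ := entries A
  obtain ⟨p, hp, s, hs, hps⟩ := exists_phase (matH A 0 0)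
    (by have := Quaternion.normSq_nonneg (a := matH A 0 1); linarith)
  obtain ⟨q, hq, t, ht, hqt⟩ := exists_phase (matH A 1 1)
    (by have := Quaternion.normSq_nonneg (a := matH A 1 0); linarith)
  set D := mkSU _ (diag_mem p q hp hq) with hD
  have hDm : matH D = !![p, 0; 0, q] := rfl
  have h1 : (etaMat (A * D)).det = 1 := by
    refine etaMat_det_boost (A * D) s t hs ht ?_ ?_
    · rw [matH_mul, hDm, ← hps]; simp [Matrix.mul_apply, Fin.sum_univ_two]
    · rw [matH_mul, hDm, ← hqt]; simp [Matrix.mul_apply, Fin.sum_univ_two]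
  rw [etaMat_mul, Matrix.det_mul, etaMat_det_diag D p q hp hq hDm, mul_one] at h1
  exact h1

/-- The double covering `η : SU(1,1;ℍ) → SO⁺(4,1)`, characterized by `A c(x) A⁻¹ = c(η(A) x)`. -/
def eta : SU11 →* SO41 where
  toFun A := ⟨⟨etaMat A, etaMat_det A⟩, by
    refine ⟨fun x y => ?_, fun x hx hx4 => ?_⟩
    · change lor (etaMat A *ᵥ x) (etaMat A *ᵥ y) = lor x y
      rw [etaMat_mulVec, etaMat_mulVec, lor_etaVec]
    · change 0 < (etaMat A *ᵥ x) 4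
      rw [etaMat_mulVec]
      exact etaVec_pos A x hx hx4⟩
  map_one' := Subtype.ext (Subtype.ext etaMat_one)
  map_mul' A B := Subtype.ext (Subtype.ext (etaMat_mul A B))

lemma cliff_eta (A : SU11) (x : Fin 5 → ℝ) :
    cliff (matR (eta A) *ᵥ x) = matH A * cliff x * matH A⁻¹ := by
  change cliff (etaMat A *ᵥ x) = _
  rw [etaMat_mulVec, cliff_etaVec]

/-- `SO(4)` is the stabilizer of `e₅` in `SO⁺(4,1)`, and `Spin(4) = η⁻¹(SO(4))`. -/
def Spin4 : Subgroup SU11 := (MulAction.stabilizer SO41 e5).comap eta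

/-! ## The complex spin representations of `Spin(4)` -/

/-- `Ψ₁ : ℍ → ℂ(2)`, `Ψ₁(a + b j) = (a b; -b̄ ā)`. -/
def psi1 (q : ℍ[ℝ]) : Matrix (Fin 2) (Fin 2) ℂ :=
  !![⟨q.re, q.imI⟩, ⟨q.imJ, q.imK⟩; -star ⟨q.imJ, q.imK⟩, star ⟨q.re, q.imI⟩]

/-- `Ψ₂ : ℍ(2) → ℂ(4)`, given by `Ψ₁` on each block. -/
def psi2 (X : Matrix (Fin 2) (Fin 2) ℍ[ℝ]) : Matrix (Fin 2 × Fin 2) (Fin 2 × Fin 2) ℂ :=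
  Matrix.of fun p q => psi1 (X p.1 q.1) p.2 q.2

lemma psi1_add (p q : ℍ[ℝ]) : psi1 (p + q) = psi1 p + psi1 q := by
  ext i j; fin_cases i <;> fin_cases j <;> simp [psi1, Complex.ext_iff] <;> ring

lemma psi1_mul (p q : ℍ[ℝ]) : psi1 (p * q) = psi1 p * psi1 q := by
  ext i j
  fin_cases i <;> fin_cases j <;>
    simp [psi1, Complex.ext_iff, Matrix.mul_apply, Fin.sum_univ_two] <;>
    constructor <;> ring

lemma psi2_mul (X Y : Matrix (Fin 2) (Fin 2) ℍ[ℝ]) : psi2 (X * Y) = psi2 X * psi2 Y := by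
  ext p q
  simp [psi2, Matrix.mul_apply, Fin.sum_univ_two, Fintype.sum_prod_type, psi1_add, psi1_mul]

/-- The matrices `E₁, …, E₅`. -/
def E (j : Fin 5) : Matrix (Fin 2) (Fin 2) ℍ[ℝ] := cliff (Pi.single j 1)

/-- The space of complex spinors `ℂ⁴`, written in blocks.  It is the complex Clifford module on
which the vector `e_j` of `ℝ⁴` acts as `Ψ₂(E_j)`. -/
abbrev Spinor : Type := Fin 2 × Fin 2 → ℂ

/-- The spin representation `Δ`, the restriction of `Ψ₂` to the spin group. -/
def spinRep (A : SU11) : Module.End ℂ Spinor := Matrix.toLin' (psi2 (matH A))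

/-- The chirality operator `i² Δ(e₁ e₂ e₃ e₄)`. -/
def chirality : Module.End ℂ Spinor :=
  Matrix.toLin' (Complex.I ^ 2 • (psi2 (E 0) * psi2 (E 1) * psi2 (E 2) * psi2 (E 3)))

/-- The spaces `W⁺` (`ε = 1`) and `W⁻` (`ε = -1`) of half spinors: eigenspaces of chirality. -/
abbrev HalfSpinor (ε : ℂ) : Submodule ℂ Spinor := Module.End.eigenspace chirality ε

lemma chirality_eq : chirality = Matrix.toLin' (psi2 J) := by
  have h : E 0 * E 1 * E 2 * E 3 = -J := by
    ext i j <;> fin_cases i <;> fin_cases j <;>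
      simp [E, cliff, J, Matrix.mul_apply, Fin.sum_univ_two]
  have hn : psi2 (-J) = -psi2 J := by
    ext ⟨i, k⟩ ⟨j, l⟩ <;> fin_cases i <;> fin_cases j <;> fin_cases k <;> fin_cases l <;>
      simp [psi2, psi1, J, Complex.ext_iff]
  rw [chirality, ← psi2_mul, ← psi2_mul, ← psi2_mul, h, hn, Complex.I_sq]
  simp

lemma cliff_e5 : cliff e5.1 = -J := by
  ext i j <;> fin_cases i <;> fin_cases j <;> simp [cliff, e5, J]

lemma spin4_comm_J (s : Spin4) : matH s.1 * J = J * matH s.1 := by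
  have h1 : matR (eta s.1) *ᵥ e5.1 = e5.1 := congrArg Subtype.val s.2
  have h := cliff_eta s.1 e5.1
  rw [h1, cliff_e5] at h
  have h2 : -J * matH s.1 = -(matH s.1 * J) := by
    rw [h, mul_assoc, matH_inv_mul, mul_one, mul_neg]
  rw [neg_mul] at h2
  exact (neg_injective h2).symm

lemma spinRep_mem (s : Spin4) (ε : ℂ) : ∀ w ∈ HalfSpinor ε, spinRep s.1 w ∈ HalfSpinor ε := by
  intro w hw
  rw [Module.End.mem_eigenspace_iff] at hw ⊢
  have hc : chirality * spinRep s.1 = spinRep s.1 * chirality := by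
    rw [chirality_eq, spinRep, Module.End.mul_eq_comp, Module.End.mul_eq_comp,
      ← Matrix.toLin'_mul, ← Matrix.toLin'_mul, ← psi2_mul, ← psi2_mul, spin4_comm_J]
  have := LinearMap.congr_fun hc w
  simp only [Module.End.mul_apply] at this
  rw [this, hw, map_smul]

/-- The half spin representations `Δ⁺` (`ε = 1`) and `Δ⁻` (`ε = -1`) of `Spin(4)`. -/
def halfSpinRep (ε : ℂ) (s : Spin4) : Module.End ℂ (HalfSpinor ε) :=
  (spinRep s.1).restrict (spinRep_mem s ε)

/-! ## Spin hyperbolic 4-manifolds and their symmetries -/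

/-- The orbit space `M = Γ\H⁴`. -/
abbrev Mfd (Γ : Subgroup SO41) : Type := MulAction.orbitRel.Quotient Γ H4

/-- The projection `H⁴ → M`, `x ↦ Γx`. -/
def toMfd (Γ : Subgroup SO41) (x : H4) : Mfd Γ := Quotient.mk'' x

/-- The bundle `Γ\SO⁺(4,1)` of positively oriented orthonormal frames of `M`: the coset `Γg`
is the frame at `Γ(g e₅)` represented by `g e₁, …, g e₄`. -/
abbrev FrameBundle (Γ : Subgroup SO41) : Type := MulAction.orbitRel.Quotient Γ SO41

/-- The coset `Γg`. -/
def toFrame (Γ : Subgroup SO41) (g : SO41) : FrameBundle Γ := Quotient.mk'' g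

/-- The spin structure `Γ̂\SU(1,1;ℍ)`, a principal `Spin(4)`-bundle over `M` by
`Γ̂ĝ ↦ Γ(η(ĝ) e₅)`, which covers the frame bundle by `Γ̂ĝ ↦ Γη(ĝ)`. -/
abbrev SpinBundle (Γh : Subgroup SU11) : Type := MulAction.orbitRel.Quotient Γh SU11

/-- The coset `Γ̂ĝ`. -/
def toSpin (Γh : Subgroup SU11) (g : SU11) : SpinBundle Γh := Quotient.mk'' g

/-- `Γ` is a discrete torsion-free subgroup of `SO⁺(4,1)` with compact quotient, that is,
`M = Γ\H⁴` is a closed hyperbolic 4-manifold. -/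
structure IsClosedHyperbolic (Γ : Subgroup SO41) : Prop where
  discrete : DiscreteTopology Γ
  torsionFree : ∀ γ ∈ Γ, IsOfFinOrder γ → γ = 1
  compact : CompactSpace (Mfd Γ)

/-- `Γ̂` is a discrete subgroup of the spin group that `η` maps isomorphically onto `Γ`. -/
structure IsSpinLift (Γ : Subgroup SO41) (Γh : Subgroup SU11) : Prop where
  discrete : DiscreteTopology Γh
  map_eq : Γh.map eta = Γ
  injOn : Set.InjOn eta Γh

/-- Near `Γx`, the map `φ : M → M` is covered by `A ∈ SO⁺(4,1)`. -/
def IsLocalLift (Γ : Subgroup SO41) (φ : Mfd Γ → Mfd Γ) (A : SO41) (x : H4) : Prop :=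
  ∀ᶠ z in 𝓝 x, φ (toMfd Γ z) = toMfd Γ (A • z)

/-- An orientation-preserving isometry of `M = Γ\H⁴`: a bijection of `M` that is locally covered
by orientation-preserving isometries of `H⁴`. -/
structure IsOrientedIsometry (Γ : Subgroup SO41) (φ : Mfd Γ → Mfd Γ) : Prop where
  bijective : Function.Bijective φ
  locally_isometry : ∀ x : H4, ∃ A : SO41, IsLocalLift Γ φ A x

/-- `φ̂` is a symmetry of the spin structure that lifts the isometry `φ` of `M`: an automorphism
of the principal `Spin(4)`-bundle `Γ̂\SU(1,1;ℍ)` that covers the map `dφ` of the frame bundle.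
If `φ` is covered by `A` near `Γ(g e₅)`, then `dφ` maps the frame `Γg` to `ΓAg`. -/
structure IsSpinSymmetry (Γ : Subgroup SO41) (Γh : Subgroup SU11) (φ : Mfd Γ → Mfd Γ)
    (φh : SpinBundle Γh ≃ₜ SpinBundle Γh) : Prop where
  equivariant : ∀ (g h : SU11) (s : Spin4),
    φh (toSpin Γh g) = toSpin Γh h → φh (toSpin Γh (g * s)) = toSpin Γh (h * s)
  covers : ∀ (g h : SU11) (A : SO41),
    IsLocalLift Γ φ A (eta g • e5) → φh (toSpin Γh g) = toSpin Γh h →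
      toFrame Γ (eta h) = toFrame Γ (A * eta g)

/-- `P` is an isolated fixed point of `φ`. -/
def IsIsolatedFixedPoint (Γ : Subgroup SO41) (φ : Mfd Γ → Mfd Γ) (P : Mfd Γ) : Prop :=
  φ P = P ∧ ∀ᶠ Q in 𝓝[≠] P, φ Q ≠ Q

/-- `φ = f_⋆`: the element `f` of the normalizer of `Γ` induces `φ` by `f_⋆(Γx) = Γfx`. -/
def InducesIsometry (Γ : Subgroup SO41) (f : SO41) (φ : Mfd Γ → Mfd Γ) : Prop :=
  f ∈ Subgroup.normalizer (Γ : Set SO41) ∧ ∀ x : H4, φ (toMfd Γ x) = toMfd Γ (f • x)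

/-- `φ̂ = f̂_⋆`: the element `f̂` of the normalizer of `Γ̂` induces `φ̂` by `f̂_⋆(Γ̂ĝ) = Γ̂f̂ĝ`. -/
def InducesSymmetry (Γh : Subgroup SU11) (f : SU11) (φh : SpinBundle Γh ≃ₜ SpinBundle Γh) :
    Prop :=
  f ∈ Subgroup.normalizer (Γh : Set SU11) ∧ ∀ g : SU11, φh (toSpin Γh g) = toSpin Γh (f * g)

/-! ## The contribution of an isolated fixed point -/

/-- The tangent space `T_y H⁴`, the Lorentz orthogonal complement of `y`. -/
def TangentH (y : H4) : Submodule ℝ (Fin 5 → ℝ) where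
  carrier := {v | lor y.1 v = 0}
  add_mem' := by
    intro u v hu hv
    simp only [Set.mem_ofPred_eq, lor, Pi.add_apply] at *
    linarith
  zero_mem' := by simp [lor]
  smul_mem' := by
    intro c v hv
    simp only [Set.mem_ofPred_eq, lor, Pi.smul_apply, smul_eq_mul] at *
    linear_combination c * hv

/-- The linear map `L` is the differential `dφ_P` at the fixed point `P = Γy`, where `T_P(M)` is
identified with `T_y H⁴` by the differential of the projection `H⁴ → M`: it is the differential at
`y` of a local lift of `φ` that fixes `y`. -/
def IsDifferentialAt (Γ : Subgroup SO41) (φ : Mfd Γ → Mfd Γ) (y : H4)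
    (L : TangentH y →ₗ[ℝ] TangentH y) : Prop :=
  ∃ A : SO41, A • y = y ∧ IsLocalLift Γ φ A y ∧
    ∀ v : TangentH y, (L v : Fin 5 → ℝ) = matR A *ᵥ (v : Fin 5 → ℝ)

/-- `ν = ν(φ̂, P)`: the contribution
`(tr Δ⁺(s) - tr Δ⁻(s)) / |det(I - dφ_P)|` of the isolated fixed point `P`, where `Γ̂ĝ` is a spin
frame over `P`, and `s ∈ Spin(4)` is defined by `φ̂(Γ̂ĝ) = Γ̂ĝs`. -/
def IsFixedPointContribution (Γ : Subgroup SO41) (Γh : Subgroup SU11) (φ : Mfd Γ → Mfd Γ)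
    (φh : SpinBundle Γh ≃ₜ SpinBundle Γh) (P : Mfd Γ) (ν : ℂ) : Prop :=
  ∃ (g : SU11) (s : Spin4) (y : H4) (L : TangentH y →ₗ[ℝ] TangentH y),
    toMfd Γ (eta g • e5) = P ∧ φh (toSpin Γh g) = toSpin Γh (g * s) ∧
    toMfd Γ y = P ∧ IsDifferentialAt Γ φ y L ∧
    ν = (LinearMap.trace ℂ _ (halfSpinRep 1 s) - LinearMap.trace ℂ _ (halfSpinRep (-1) s)) /
      ((|LinearMap.det (LinearMap.id - L)| : ℝ) : ℂ)

end

end HypSpin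

namespace HypSpin

open Filter

/-! ## Topology of `H⁴` and of its isometries -/

/-! Two lifts of one isometry of M near a point differ by an element of Γ: otherwise a neighbourhood
in ℝ⁵ would be covered by countably many proper subspaces ker(A − γB), which have measure zero
(`exists_eq_mul_of_eventually`). As H⁴ is connected, a local lift is global
(`IsOrientedIsometry.lift_global`), and an element of Γ corrects it to fix x. Uniqueness holds
because Γ acts freely: stabilizers of points of H⁴ are compact, so a point stabilizer in a discrete
group consists of elements of finite order (`isOfFinOrder_of_fixed`).

The kernel of η is {1, −1}, so φ̂ and left multiplication by a lift of Φ agree up to a sign at each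
spin frame. Along the continuous section `boost` over the connected space H⁴ the sign is constant,
because Γ̂\SU(1,1;ℍ) is Hausdorff; equivariance under Spin(4) does the rest
(`IsSpinSymmetry.eq_mul_left`). One sign agrees with φ̂, and this gives Φ̂.

For a frame g at x write Φ̂g = gs with s = diag(p, q), where p and q are unit quaternions. The half
spin traces are 2 Re p and 2 Re q. In the frame g the differential is v ↦ p v q̄ on ℍ = ℝ⁴, and
det(I − dφ) = 4(Re p − Re q)² (`det_one_sub_mul`). Thus ν = 1/(2(Re p − Re q)). Conjugation by g
multiplies the difference of the real parts of the diagonal entries by x₅ (`re_sub_re_conj`), which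
gives the formula. If Re p = Re q, then I − dφ has a kernel and a whole geodesic through x is fixed,
contrary to isolation. -/

lemma H4.isInducing_val : Topology.IsInducing (fun z : H4 => z.1) := ⟨rfl⟩

lemma H4.continuous_val : Continuous (fun z : H4 => z.1) := H4.isInducing_val.continuous

lemma smul_val (M : SO41) (z : H4) : (M • z).1 = matR M *ᵥ z.1 := rfl

lemma matR_injective : Function.Injective matR := fun _ _ h => Subtype.ext (Subtype.ext h)

lemma toMfd_eq_iff {Γ : Subgroup SO41} {a b : H4} :
    toMfd Γ a = toMfd Γ b ↔ ∃ γ ∈ Γ, γ • b = a := by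
  unfold toMfd
  rw [Quotient.eq'', MulAction.orbitRel_apply]
  constructor
  · rintro ⟨γ, h⟩; exact ⟨γ.1, γ.2, h⟩
  · rintro ⟨γ, h, h'⟩; exact ⟨⟨γ, h⟩, h'⟩

lemma toFrame_eq_iff {Γ : Subgroup SO41} {a b : SO41} :
    toFrame Γ a = toFrame Γ b ↔ ∃ γ ∈ Γ, γ * b = a := by
  unfold toFrame
  rw [Quotient.eq'', MulAction.orbitRel_apply]
  constructor
  · rintro ⟨γ, h⟩; exact ⟨γ.1, γ.2, h⟩
  · rintro ⟨γ, h, h'⟩; exact ⟨⟨γ, h⟩, h'⟩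

lemma toSpin_eq_iff {Γ : Subgroup SU11} {a b : SU11} :
    toSpin Γ a = toSpin Γ b ↔ ∃ γ ∈ Γ, γ * b = a := by
  unfold toSpin
  rw [Quotient.eq'', MulAction.orbitRel_apply]
  constructor
  · rintro ⟨γ, h⟩; exact ⟨γ.1, γ.2, h⟩
  · rintro ⟨γ, h, h'⟩; exact ⟨⟨γ, h⟩, h'⟩

lemma toMfd_smul {Γ : Subgroup SO41} {γ : SO41} (h : γ ∈ Γ) (z : H4) :
    toMfd Γ (γ • z) = toMfd Γ z := toMfd_eq_iff.mpr ⟨γ, h, rfl⟩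

lemma continuous_lor_self : Continuous (fun y : Fin 5 → ℝ => lor y y) := by
  unfold lor; fun_prop

lemma lor_smul_smul (r : ℝ) (y : Fin 5 → ℝ) : lor (r • y) (r • y) = r ^ 2 * lor y y := by
  simp [lor]; ring

/-- A property that holds near a point of `H⁴` holds, after rescaling, near that point in `ℝ⁵`. -/
lemma eventually_cone (z : H4) {p : H4 → Prop} (h : ∀ᶠ w in 𝓝 z, p w) :
    ∀ᶠ y in 𝓝 z.1, ∃ (w : H4) (r : ℝ), 0 < r ∧ p w ∧ w.1 = r • y := by
  rw [H4.isInducing_val.nhds_eq_comap, eventually_comap] at h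
  -- The rescaling y ↦ y/√(−⟨y,y⟩) is continuous at z and fixes z, so it pulls neighbourhoods of z
  -- in H⁴ back to neighbourhoods in ℝ⁵.
  have hc : ContinuousAt (fun y : Fin 5 → ℝ => (√(-lor y y))⁻¹ • y) z.1 := by
    refine ContinuousAt.smul (f := fun y : Fin 5 → ℝ => (√(-lor y y))⁻¹)
      (ContinuousAt.inv₀ ?_ ?_) continuousAt_id
    · exact (Real.continuous_sqrt.comp continuous_lor_self.neg).continuousAt
    · rw [z.2.1]; simp
  have hv : (√(-lor z.1 z.1))⁻¹ • z.1 = z.1 := by rw [z.2.1]; simp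
  rw [ContinuousAt, hv] at hc
  have h1 : ∀ᶠ y in 𝓝 z.1, lor y y < 0 :=
    continuous_lor_self.continuousAt.eventually_lt continuousAt_const (by rw [z.2.1]; norm_num)
  have h2 : ∀ᶠ y in 𝓝 z.1, 0 < y 4 :=
    continuousAt_const.eventually_lt (continuous_apply 4).continuousAt z.2.2
  filter_upwards [hc.eventually h, h1, h2] with y hy hy1 hy2
  have hr : 0 < (√(-lor y y))⁻¹ := inv_pos.mpr (Real.sqrt_pos.mpr (by linarith))
  refine ⟨⟨(√(-lor y y))⁻¹ • y, ?_, ?_⟩, _, hr, hy _ rfl, rfl⟩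
  · rw [lor_smul_smul, inv_pow, Real.sq_sqrt (by linarith)]
    rw [inv_neg, neg_mul, inv_mul_cancel₀ hy1.ne]
  · simpa using mul_pos hr hy2

/-- A subspace of a second countable space is separable, and a separable discrete space is
countable. Countability is what the measure-zero arguments below need. -/
lemma countable_of_discrete (Γ : Subgroup SO41) (h : DiscreteTopology Γ) : Countable Γ := by
  have : SecondCountableTopology (Matrix (Fin 5) (Fin 5) ℝ) :=
    inferInstanceAs (SecondCountableTopology (Fin 5 → Fin 5 → ℝ))
  have : SecondCountableTopology (Matrix.SpecialLinearGroup (Fin 5) ℝ) :=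
    (Topology.IsInducing.subtypeVal (t := {A : Matrix (Fin 5) (Fin 5) ℝ |
      A.det = 1})).secondCountableTopology
  exact TopologicalSpace.separableSpace_iff_countable.mp inferInstance

/-- Isometries of `H⁴` that agree modulo a countable group `Γ` on an open set differ by an element
of `Γ`. -/
lemma exists_eq_mul_of_eventually {Γ : Subgroup SO41} [Countable Γ] {A B : SO41} {z : H4}
    (h : ∀ᶠ w in 𝓝 z, toMfd Γ (A • w) = toMfd Γ (B • w)) : ∃ γ ∈ Γ, A = γ * B := by
  by_contra hne
  push Not at hne
  have h1 := eventually_cone z h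
  -- The vectors on which A and γB agree. Membership is invariant under scaling, so the condition on
  -- H⁴ passes to an open set of ℝ⁵.
  set K : Γ → Submodule ℝ (Fin 5 → ℝ) := fun γ =>
    LinearMap.ker (Matrix.mulVecLin (matR A - matR (γ.1 * B))) with hK
  have hKt : ∀ γ, K γ ≠ ⊤ := by
    intro γ hγ
    refine hne γ.1 γ.2 (matR_injective ?_)
    rw [hK, LinearMap.ker_eq_top] at hγ
    refine sub_eq_zero.mp (Matrix.ext_of_mulVec_single fun i => ?_)
    rw [Matrix.zero_mulVec]
    exact LinearMap.congr_fun hγ (Pi.single i 1)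
  have h2 : ∀ᶠ y in 𝓝 z.1, y ∈ ⋃ γ, (K γ : Set (Fin 5 → ℝ)) := by
    filter_upwards [h1] with y hy
    obtain ⟨w, r, hr, hw, hwy⟩ := hy
    obtain ⟨γ, hγ, hγw⟩ := toMfd_eq_iff.mp hw
    refine Set.mem_iUnion.mpr ⟨⟨γ, hγ⟩, ?_⟩
    have h3 := congrArg Subtype.val hγw
    rw [← mul_smul, smul_val, smul_val, hwy, Matrix.mulVec_smul, Matrix.mulVec_smul] at h3
    have h4 := smul_right_injective _ hr.ne' h3
    change (matR A - matR (γ * B)) *ᵥ y = 0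
    rw [Matrix.sub_mulVec, h4, sub_self]
  have h5 := MeasureTheory.Measure.measure_pos_of_mem_nhds
    (MeasureTheory.volume : MeasureTheory.Measure (Fin 5 → ℝ)) h2
  refine h5.ne' (MeasureTheory.measure_iUnion_null fun γ => ?_)
  exact MeasureTheory.Measure.addHaar_submodule _ _ (hKt γ)

/-! ### Connectedness of H⁴ and global lifts of isometries -/

/-- The point of `H⁴` over a point of `ℝ⁴`. -/
noncomputable def graphPoint (v : Fin 4 → ℝ) : H4 :=
  ⟨![v 0, v 1, v 2, v 3, √(1 + (v 0 ^ 2 + v 1 ^ 2 + v 2 ^ 2 + v 3 ^ 2))], by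
    have := Real.mul_self_sqrt
      (show 0 ≤ 1 + (v 0 ^ 2 + v 1 ^ 2 + v 2 ^ 2 + v 3 ^ 2) by positivity)
    simp [lor]; linarith, by
    simp; positivity⟩

lemma continuous_graphPoint : Continuous graphPoint := by
  refine H4.isInducing_val.continuous_iff.mpr (continuous_pi fun i => ?_)
  fin_cases i <;> simp [graphPoint] <;> fun_prop

lemma graphPoint_surjective : Function.Surjective graphPoint := by
  intro z
  refine ⟨![z.1 0, z.1 1, z.1 2, z.1 3], Subtype.ext (funext fun i => ?_)⟩
  have h := z.2.1
  have h4 := z.2.2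
  simp only [lor] at h
  fin_cases i <;> simp [graphPoint]
  rw [Real.sqrt_eq_iff_mul_self_eq (by positivity) h4.le]
  linarith

instance : PreconnectedSpace H4 :=
  ⟨graphPoint_surjective.range_eq ▸ isPreconnected_range continuous_graphPoint⟩

/-- A local lift of an isometry at one point lifts it everywhere. -/
lemma IsOrientedIsometry.lift_global {Γ : Subgroup SO41} [Countable Γ] {φ : Mfd Γ → Mfd Γ}
    (hφ : IsOrientedIsometry Γ φ) {A : SO41} {x : H4} (hA : IsLocalLift Γ φ A x) (z : H4) :
    IsLocalLift Γ φ A z := by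
  have hopen : IsOpen {w | IsLocalLift Γ φ A w} := isOpen_iff_mem_nhds.mpr fun w hw =>
    eventually_eventually_nhds.mpr hw
  have hclosed : IsClosed {w | IsLocalLift Γ φ A w} := by
    refine isClosed_of_closure_subset fun w hw => ?_
    -- At a limit point w take a local lift B. Both A and B lift φ near some u close to w, so B =
    -- γA, and γ is invisible in M.
    obtain ⟨B, hB⟩ := hφ.locally_isometry w
    obtain ⟨u, huB, huA⟩ := mem_closure_iff_nhds.mp hw _ (eventually_eventually_nhds.mpr hB)
    obtain ⟨γ, hγ, rfl⟩ := exists_eq_mul_of_eventually (Γ := Γ) (A := B) (B := A) (z := u) (by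
      filter_upwards [huB, huA] with v h1 h2
      rw [← h1, h2])
    filter_upwards [hB] with v hv
    rw [hv, mul_smul, toMfd_smul hγ]
  have := IsClopen.eq_univ ⟨hclosed, hopen⟩ ⟨x, hA⟩
  exact (Set.ext_iff.mp this z).mpr (Set.mem_univ z)

/-- An isometry that is globally covered by `Φ` is induced by `Φ`, which normalizes `Γ`. -/
lemma inducesIsometry_of_lift {Γ : Subgroup SO41} [Countable Γ] {φ : Mfd Γ → Mfd Γ}
    (hφ : Function.Injective φ) {Φ : SO41} (h : ∀ z, φ (toMfd Γ z) = toMfd Γ (Φ • z)) :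
    InducesIsometry Γ Φ φ := by
  refine ⟨Subgroup.mem_normalizer_iff.mpr fun γ => ⟨fun hγ => ?_, fun hγ => ?_⟩, h⟩
  · obtain ⟨δ, hδ, e⟩ := exists_eq_mul_of_eventually (Γ := Γ) (A := Φ * γ) (B := Φ) (z := e5)
      (Eventually.of_forall fun w => by rw [mul_smul, ← h, ← h, toMfd_smul hγ])
    rw [e]; simpa using hδ
  -- Here injectivity of φ enters: if ΦγΦ⁻¹ lies in Γ, then γw and w have the same image under φ, so
  -- γ covers the identity of M.
  · obtain ⟨δ, hδ, e⟩ := exists_eq_mul_of_eventually (Γ := Γ) (A := γ) (B := 1) (z := e5)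
      (Eventually.of_forall fun w => hφ (by
        rw [h, h, one_smul, ← mul_smul, ← toMfd_smul hγ (Φ • w), ← mul_smul]; simp))
    rw [e]; simpa using hδ

lemma InducesIsometry.isLocalLift {Γ : Subgroup SO41} {φ : Mfd Γ → Mfd Γ} {Φ : SO41}
    (h : InducesIsometry Γ Φ φ) (z : H4) : IsLocalLift Γ φ Φ z := Eventually.of_forall h.2

/-- An oriented isometry that fixes `Γx` is induced by an element that fixes `x`. -/
lemma IsOrientedIsometry.exists_lift_fixing {Γ : Subgroup SO41} [Countable Γ]
    {φ : Mfd Γ → Mfd Γ} (hφ : IsOrientedIsometry Γ φ) {x : H4}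
    (hx : φ (toMfd Γ x) = toMfd Γ x) : ∃ Φ : SO41, InducesIsometry Γ Φ φ ∧ Φ • x = x := by
  obtain ⟨A, hA⟩ := hφ.locally_isometry x
  have hAx := hA.self_of_nhds
  rw [hx] at hAx
  obtain ⟨γ, hγ, hγx⟩ := toMfd_eq_iff.mp hAx
  refine ⟨γ * A, inducesIsometry_of_lift hφ.bijective.1 fun z => ?_, by rw [mul_smul, hγx]⟩
  rw [mul_smul, toMfd_smul hγ]
  exact (hφ.lift_global hA z).self_of_nhds

/-! ## The kernel of `η` and a continuous section over `H⁴` -/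

lemma matH_injective : Function.Injective matH := fun _ _ h => Subtype.ext (Units.ext h)

/-- The element `-1` of `SU(1,1;ℍ)`. -/
noncomputable def negOne : SU11 := mkSU (-1) (by simp)

lemma matH_negOne : matH negOne = -1 := rfl

lemma negOne_mul_comm (A : SU11) : negOne * A = A * negOne :=
  matH_injective (by simp [matH_mul, matH_negOne])

lemma negOne_ne_one : negOne ≠ 1 := by
  intro h
  have h1 := congrArg (fun A => (matH A 0 0).re) h
  simp [matH_negOne, matH_one] at h1
  norm_num at h1

lemma cliff_matR_injective {M N : SO41}
    (h : ∀ x, cliff (matR M *ᵥ x) = cliff (matR N *ᵥ x)) : M = N := by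
  refine Subtype.ext (Subtype.ext (Matrix.ext_of_mulVec_single fun i => ?_))
  exact cliff_injective (h _)

lemma eta_negOne : eta negOne = 1 := by
  refine cliff_matR_injective fun x => ?_
  rw [cliff_eta, matR_one, Matrix.one_mulVec, matH_inv, matH_negOne]
  simp [J_sq]

lemma matH_mul_cliff (A : SU11) (x : Fin 5 → ℝ) :
    matH A * cliff x = cliff (matR (eta A) *ᵥ x) * matH A := by
  rw [cliff_eta, mul_assoc, matH_inv_mul, mul_one]

/-- An element of the kernel commutes with every Clifford vector. Commuting with E₅ kills the
off-diagonal entries, E₁ makes the diagonal entries equal, and E₂, E₃ make them real; their norm is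
one. -/
lemma eta_eq_one {A : SU11} (h : eta A = 1) : A = 1 ∨ A = negOne := by
  have hc : ∀ x, matH A * cliff x = cliff x * matH A := fun x => by
    rw [matH_mul_cliff, h, matR_one, Matrix.one_mulVec]
  have c5 := hc e5.1
  have c1 := hc ![1, 0, 0, 0, 0]
  have c2 := hc ![0, 1, 0, 0, 0]
  have c3 := hc ![0, 0, 1, 0, 0]
  have a01 := congrFun (congrFun c5 0) 1
  have a10 := congrFun (congrFun c5 1) 0
  have b1 := congrFun (congrFun c1 0) 1
  have b2 := congrFun (congrFun c2 0) 1
  have b3 := congrFun (congrFun c3 0) 1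
  simp [cliff, e5, Matrix.mul_apply, Fin.sum_univ_two, Quaternion.ext_iff]
    at a01 a10 b1 b2 b3
  have e1 := (entries A).1
  simp only [Quaternion.normSq_def'] at e1
  obtain ⟨x1, x2, x3, x4⟩ := a01
  obtain ⟨y1, y2, y3, y4⟩ := a10
  obtain ⟨u1, u2, u3, u4⟩ := b1
  obtain ⟨v1, v2, v3, v4⟩ := b2
  obtain ⟨w1, w2, w3, w4⟩ := b3
  have z01 : matH A 0 1 = 0 := by ext <;> simp <;> linarith
  have z10 : matH A 1 0 = 0 := by ext <;> simp <;> linarith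
  have i0 : (matH A 0 0).imI = 0 := by linarith
  have j0 : (matH A 0 0).imJ = 0 := by linarith
  have k0 : (matH A 0 0).imK = 0 := by linarith
  have z11 : matH A 1 1 = matH A 0 0 := by ext <;> linarith
  rw [z01, i0, j0, k0] at e1
  simp at e1
  rcases e1 with e1 | e1
  · left
    apply matH_injective
    rw [matH_one]
    have z00 : matH A 0 0 = 1 := by ext <;> simp [i0, j0, k0, e1]
    ext1 i j
    fin_cases i <;> fin_cases j <;> simp [z01, z10, z11, z00]
  · right
    apply matH_injective
    rw [matH_negOne]
    have z00 : matH A 0 0 = -1 := by ext <;> simp [i0, j0, k0, e1]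
    ext1 i j
    fin_cases i <;> fin_cases j <;> simp [z01, z10, z11, z00]

lemma eta_eq_iff {A B : SU11} : eta A = eta B ↔ A = B ∨ A = negOne * B := by
  constructor
  · intro h
    have : eta (A * B⁻¹) = 1 := by rw [map_mul, map_inv, h, mul_inv_cancel]
    rcases eta_eq_one this with h | h
    · left; rw [← mul_inv_eq_one, h]
    · right; rw [← h]; simp
  · rintro (rfl | rfl)
    · rfl
    · rw [map_mul, eta_negOne, one_mul]

/-- The matrix of the boost that moves `e₅` to `x`. -/
noncomputable def boostMat (x : Fin 5 → ℝ) : Matrix (Fin 2) (Fin 2) ℍ[ℝ] :=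
  (√(2 * (x 4 + 1)))⁻¹ • !![quat (x 4 + 1) 0 0 0, quat (x 0) (x 1) (x 2) (x 3);
    quat (x 0) (-x 1) (-x 2) (-x 3), quat (x 4 + 1) 0 0 0]

lemma boostMat_star (x : Fin 5 → ℝ) : (boostMat x)ᴴ = boostMat x := by
  ext i j <;> fin_cases i <;> fin_cases j <;> simp [boostMat]

lemma sq_boost_coeff (x : H4) : (√(2 * (x.1 4 + 1)))⁻¹ * ((√(2 * (x.1 4 + 1)))⁻¹ *
    (2 * (x.1 4 + 1))) = 1 := by
  have h4 := x.2.2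
  have h : 0 < 2 * (x.1 4 + 1) := by linarith
  rw [← mul_assoc, ← mul_inv, Real.mul_self_sqrt h.le, inv_mul_cancel₀ h.ne']

lemma boostMat_mem (x : H4) : (boostMat x.1)ᴴ * J * boostMat x.1 = J := by
  have hk := sq_boost_coeff x
  have hl := x.2.1
  simp only [lor] at hl
  rw [boostMat_star]
  unfold boostMat
  -- Of the normalizing factor only 2k²(x₅ + 1) = 1 is used.
  generalize (√(2 * (x.1 4 + 1)))⁻¹ = k at hk ⊢
  ext i j <;> fin_cases i <;> fin_cases j <;>
    simp [J, Matrix.mul_apply, Fin.sum_univ_two,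
      -mul_eq_mul_left_iff, -mul_eq_mul_right_iff] <;>
    first
    | ring1
    | (right; ring1)
    | linear_combination hk - k ^ 2 * hl
    | linear_combination -hk + k ^ 2 * hl

/-- The boost that moves `e₅` to `x`. -/
noncomputable def boost (x : H4) : SU11 := mkSU (boostMat x.1) (boostMat_mem x)

lemma matH_boost (x : H4) : matH (boost x) = boostMat x.1 := rfl

/-- The boost matrix B is Hermitian, so B⁻¹ = JBJ, and c(e₅) = −J turns the claim into B² = −c(x)J.
With N = −c(x)J, the condition ⟨x,x⟩ = −1 gives N² = 2x₅N − 1, whence (1 + N)² = 2(x₅ + 1)N; thus B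
= (1 + N)/√(2(x₅ + 1)) is a square root of N. -/
lemma eta_boost_smul (x : H4) : eta (boost x) • e5 = x := by
  refine Subtype.ext (cliff_injective ?_)
  change cliff (matR (eta (boost x)) *ᵥ e5.1) = _
  have hk := sq_boost_coeff x
  have hl := x.2.1
  simp only [lor] at hl
  rw [cliff_eta, matH_inv, matH_boost, boostMat_star, cliff_e5]
  unfold boostMat
  generalize (√(2 * (x.1 4 + 1)))⁻¹ = k at hk ⊢
  ext i j <;> fin_cases i <;> fin_cases j <;>
    simp [cliff, J, Matrix.mul_apply, Fin.sum_univ_two,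
      -mul_eq_mul_left_iff, -mul_eq_mul_right_iff] <;>
    first
    | ring1
    | (right; ring1)
    | linear_combination (x.1 0) * hk
    | linear_combination (x.1 1) * hk
    | linear_combination (x.1 2) * hk
    | linear_combination (x.1 3) * hk
    | linear_combination (-x.1 0) * hk
    | linear_combination (x.1 4) * hk + k ^ 2 * hl
    | linear_combination (-x.1 4) * hk - k ^ 2 * hl

lemma continuous_quat {X : Type*} [TopologicalSpace X] {a b c d : X → ℝ} (ha : Continuous a)
    (hb : Continuous b) (hc : Continuous c) (hd : Continuous d) :
    Continuous fun z => quat (a z) (b z) (c z) (d z) := by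
  have : Continuous fun z => Quaternion.linearIsometryEquivTuple.symm !₂[a z, b z, c z, d z] := by
    refine Quaternion.linearIsometryEquivTuple.symm.continuous.comp ?_
    refine (PiLp.continuous_toLp 2 _).comp (continuous_pi fun i => ?_)
    fin_cases i <;> simpa
  exact this

lemma continuous_boostMat : Continuous fun x : H4 => boostMat x.1 := by
  have hi : ∀ i, Continuous fun z : H4 => z.1 i := fun i =>
    (continuous_apply i).comp H4.continuous_val
  unfold boostMat
  refine Continuous.smul (f := fun x : H4 => (√(2 * (x.1 4 + 1)))⁻¹) (Continuous.inv₀ ?_ ?_) ?_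
  · exact Real.continuous_sqrt.comp (continuous_const.mul ((hi 4).add continuous_const))
  · intro x
    have := x.2.2
    exact (Real.sqrt_pos.mpr (by linarith)).ne'
  · refine continuous_matrix fun i j => ?_
    fin_cases i <;> fin_cases j <;> simp <;>
      first
      | exact continuous_quat ((hi 4).add continuous_const) continuous_const continuous_const
          continuous_const
      | exact continuous_quat (hi 0) (hi 1) (hi 2) (hi 3)
      | exact continuous_quat (hi 0) (hi 1).neg (hi 2).neg (hi 3).neg

/-- The topology on units also sees the inverse, which is JB*J here. Thus `boost` is a continuous
section of ĝ ↦ η(ĝ)e₅, along which signs can be compared. -/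
lemma continuous_boost : Continuous boost := by
  refine Topology.IsInducing.subtypeVal.continuous_iff.mpr (Units.continuous_iff.mpr ⟨?_, ?_⟩)
  · exact continuous_boostMat
  · have : Continuous fun x : H4 => J * (boostMat x.1)ᴴ * J :=
      (continuous_const.mul continuous_boostMat.matrix_conjTranspose).mul continuous_const
    exact this

/-! ## Stabilizers of points of `H⁴` in a discrete group -/

/-- The last column is e₅. Every other column is Lorentz orthogonal to it, so its time-like entry
vanishes and it is a Euclidean unit vector. -/
lemma abs_entry_le_one {C : SO41} (h : C • e5 = e5) (i j : Fin 5) : |matR C i j| ≤ 1 := by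
  have hc : matR C *ᵥ Pi.single 4 1 = Pi.single 4 1 := by
    have := congrArg Subtype.val h
    have he : (e5.1 : Fin 5 → ℝ) = Pi.single 4 1 := by
      ext i; fin_cases i <;> simp [e5]
    rw [← he]; exact this
  have hpres := C.2.1
  rw [← sq_le_one_iff_abs_le_one]
  by_cases hj : j = 4
  · subst hj
    have := congrFun hc i
    rw [Matrix.mulVec_single_one, Matrix.col_apply] at this
    rw [this]
    by_cases hi : i = 4
    · simp [hi]
    · simp [hi]
  · have h1 := hpres (Pi.single j 1) (Pi.single 4 1)
    have h2 := hpres (Pi.single j 1) (Pi.single j 1)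
    change lor (matR C *ᵥ _) (matR C *ᵥ _) = _ at h1 h2
    rw [hc] at h1
    rw [Matrix.mulVec_single_one] at h1 h2
    have hr1 : lor (Pi.single j 1) (Pi.single 4 1) = 0 := by
      fin_cases j <;> simp [lor] at hj ⊢
    have hr2 : lor (Pi.single j 1) (Pi.single j 1) = 1 := by
      fin_cases j <;> simp [lor] at hj ⊢
    rw [hr1] at h1
    rw [hr2] at h2
    simp [lor, Matrix.col_apply] at h1 h2
    rw [h1] at h2
    fin_cases i <;> simp only [h1, Fin.zero_eta, Fin.mk_one, Fin.reduceFinMk] <;>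
      nlinarith [sq_nonneg (matR C 0 j), sq_nonneg (matR C 1 j), sq_nonneg (matR C 2 j),
        sq_nonneg (matR C 3 j)]

lemma matR_det (M : SO41) : (matR M).det = 1 := M.1.2

lemma matR_inv (M : SO41) : matR M⁻¹ = (matR M).adjugate := by
  simp [matR, Matrix.SpecialLinearGroup.coe_inv]

/-- An element of a discrete subgroup of `SO⁺(4,1)` that fixes a point has finite order. -/
lemma isOfFinOrder_of_fixed {Γ : Subgroup SO41} (hΓ : DiscreteTopology Γ) {γ : SO41}
    (hγ : γ ∈ Γ) {x : H4} (hx : γ • x = x) : IsOfFinOrder γ := by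
  set g := eta (boost x) with hg
  have hgx : g • e5 = x := eta_boost_smul x
  -- Conjugation by g moves the fixed point to e₅, where the entries of all powers of γ are bounded
  -- by one; K is the compact set so obtained.
  set K : Set (Matrix (Fin 5) (Fin 5) ℝ) :=
    (fun X : Matrix (Fin 5) (Fin 5) ℝ => matR g * X * matR g⁻¹) ''
      Set.pi Set.univ fun _ => Set.pi Set.univ fun _ => Set.Icc (-1 : ℝ) 1 with hK
  have hKc : IsCompact K := by
    refine IsCompact.image ?_ (by fun_prop)
    exact isCompact_univ_pi fun _ => isCompact_univ_pi fun _ => isCompact_Icc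
  have hmem : ∀ n : ℕ, matR (γ ^ n) ∈ K := by
    intro n
    refine ⟨matR (g⁻¹ * γ ^ n * g), fun i _ j _ => ?_, ?_⟩
    · refine abs_le.mp (abs_entry_le_one ?_ i j)
      have hn : γ ^ n • x = x := by
        induction n with
        | zero => simp
        | succ n ih => rw [pow_succ, mul_smul, hx, ih]
      rw [mul_smul, mul_smul, hgx, hn, inv_smul_eq_iff, hgx]
    · change matR g * (matR (g⁻¹ * γ ^ n * g) : Matrix _ _ _) * matR g⁻¹ = _
      rw [← matR_mul, ← matR_mul]
      congr 1
      group
  have : FirstCountableTopology (Matrix (Fin 5) (Fin 5) ℝ) :=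
    inferInstanceAs (FirstCountableTopology (Fin 5 → Fin 5 → ℝ))
  obtain ⟨a, -, s, hs, ht⟩ := hKc.tendsto_subseq hmem
  have ht1 := ht.comp (tendsto_add_atTop_nat 1)
  have hdet : a.det = 1 := by
    have hd : Continuous fun X : Matrix (Fin 5) (Fin 5) ℝ => X.det := continuous_id.matrix_det
    have h0 := (hd.tendsto a).comp ht
    have hone : ((fun X : Matrix (Fin 5) (Fin 5) ℝ => X.det) ∘
        (fun n => matR (γ ^ n)) ∘ s) = fun _ => 1 := by
      funext n
      simp only [Function.comp, matR_det]
    rw [hone] at h0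
    exact tendsto_nhds_unique h0 tendsto_const_nhds
  -- Quotients of consecutive terms of the convergent subsequence tend to a⁻¹a = 1. The adjugate
  -- serves as the inverse, since all determinants are one.
  have hlim : Tendsto (fun n => matR (γ ^ (s (n + 1) - s n))) atTop (𝓝 1) := by
    have h1 := (((continuous_id.matrix_adjugate).tendsto a).comp ht).mul ht1
    rw [id, Matrix.adjugate_mul, hdet, one_smul] at h1
    refine h1.congr fun n => ?_
    have hle : s n ≤ s (n + 1) := (hs (Nat.lt_succ_self n)).le
    simp only [Function.comp, id]
    rw [← matR_inv, ← matR_mul]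
    congr 1
    rw [inv_mul_eq_iff_eq_mul, ← pow_add, Nat.add_sub_cancel' hle]
  have hind : Topology.IsInducing (fun δ : Γ => matR δ.1) :=
    (Topology.IsInducing.subtypeVal.comp Topology.IsInducing.subtypeVal).comp
      Topology.IsInducing.subtypeVal
  have hlim' : Tendsto (fun n => (⟨γ ^ (s (n + 1) - s n), Γ.pow_mem hγ _⟩ : Γ)) atTop
      (𝓝 1) := by
    rw [hind.tendsto_nhds_iff]
    change Tendsto (fun n => matR (γ ^ (s (n + 1) - s n))) atTop (𝓝 (matR 1))
    rwa [matR_one]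
  -- By discreteness these powers eventually equal 1, and their exponents are positive because s is
  -- strictly increasing.
  rw [nhds_discrete, tendsto_pure] at hlim'
  obtain ⟨n, hn⟩ := hlim'.exists
  have hn' : γ ^ (s (n + 1) - s n) = 1 := congrArg Subtype.val hn
  exact isOfFinOrder_iff_pow_eq_one.mpr ⟨_, Nat.sub_pos_of_lt (hs (Nat.lt_succ_self n)), hn'⟩

lemma IsClosedHyperbolic.free {Γ : Subgroup SO41} (hΓ : IsClosedHyperbolic Γ) {γ : SO41}
    (hγ : γ ∈ Γ) {x : H4} (hx : γ • x = x) : γ = 1 :=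
  hΓ.torsionFree γ hγ (isOfFinOrder_of_fixed hΓ.discrete hγ hx)

/-! ## Lifts of isometries to the spin structure -/

lemma continuous_toSpin (Γh : Subgroup SU11) : Continuous (toSpin Γh) := continuous_quotient_mk'

/-- The quotient map is open, and the equivalence relation is the preimage of Γ̂ under (a, b) ↦
ab⁻¹; a discrete subgroup is closed. The Hausdorff property makes the set where two continuous maps
agree closed. -/
lemma t2Space_spinBundle {Γh : Subgroup SU11} (h : DiscreteTopology Γh) :
    T2Space (SpinBundle Γh) := by
  have hq : IsOpenQuotientMap (toSpin Γh) := MulAction.isOpenQuotientMap_quotientMk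
  rw [t2Space_iff_of_isOpenQuotientMap hq]
  have hc : IsClosed (Γh : Set SU11) := Subgroup.isClosed_of_discrete
  have : {q : SU11 × SU11 | toSpin Γh q.1 = toSpin Γh q.2} =
      (fun q : SU11 × SU11 => q.1 * q.2⁻¹) ⁻¹' (Γh : Set SU11) := by
    ext q
    rw [Set.mem_ofPred_eq, toSpin_eq_iff]
    constructor
    · rintro ⟨γ, hγ, h⟩
      simpa [← h] using hγ
    · intro h
      exact ⟨_, h, by simp⟩
  rw [this]
  exact hc.preimage (continuous_fst.mul continuous_snd.inv)

lemma IsSpinLift.exists_lift {Γ : Subgroup SO41} {Γh : Subgroup SU11} (h : IsSpinLift Γ Γh)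
    {γ : SO41} (hγ : γ ∈ Γ) : ∃ γh ∈ Γh, eta γh = γ := by
  rw [← h.map_eq] at hγ
  exact hγ

lemma IsSpinLift.eta_mem {Γ : Subgroup SO41} {Γh : Subgroup SU11} (h : IsSpinLift Γ Γh)
    {γ : SU11} (hγ : γ ∈ Γh) : eta γ ∈ Γ := by
  rw [← h.map_eq]
  exact ⟨γ, hγ, rfl⟩

lemma IsSpinLift.eq_one {Γ : Subgroup SO41} {Γh : Subgroup SU11} (h : IsSpinLift Γ Γh)
    {γ : SU11} (hγ : γ ∈ Γh) (he : eta γ = 1) : γ = 1 :=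
  h.injOn hγ Γh.one_mem (by rw [he, map_one])

/-- Otherwise −1 would lie in Γ̂, against injectivity of η there. So the two alternatives of
`IsSpinLift.toSpin_eq_or` exclude each other. -/
lemma IsSpinLift.toSpin_negOne_mul_ne {Γ : Subgroup SO41} {Γh : Subgroup SU11}
    (h : IsSpinLift Γ Γh) (a : SU11) : toSpin Γh a ≠ toSpin Γh (negOne * a) := by
  intro hc
  obtain ⟨γ, hγ, e⟩ := toSpin_eq_iff.mp hc
  have h1 : γ * negOne = 1 := mul_right_cancel (b := a) (by rw [mul_assoc, e, one_mul])
  have h2 : γ = 1 := h.eq_one hγ (by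
    have := congrArg eta h1
    rwa [map_mul, eta_negOne, mul_one, map_one] at this)
  rw [h2, one_mul] at h1
  exact negOne_ne_one h1

/-- Points over the same frame of a spin structure differ by a sign. -/
lemma IsSpinLift.toSpin_eq_or {Γ : Subgroup SO41} {Γh : Subgroup SU11} (h : IsSpinLift Γ Γh)
    {a b : SU11} (hab : toFrame Γ (eta a) = toFrame Γ (eta b)) :
    toSpin Γh a = toSpin Γh b ∨ toSpin Γh a = toSpin Γh (negOne * b) := by
  obtain ⟨γ, hγ, e⟩ := toFrame_eq_iff.mp hab
  obtain ⟨γh, hγh, rfl⟩ := h.exists_lift hγ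
  rw [← map_mul] at e
  rcases eta_eq_iff.mp e.symm with rfl | rfl
  · exact Or.inl (toSpin_eq_iff.mpr ⟨γh, hγh, rfl⟩)
  · refine Or.inr (toSpin_eq_iff.mpr ⟨γh, hγh, ?_⟩)
    rw [← mul_assoc, ← mul_assoc, negOne_mul_comm]

lemma toSpin_surjective (Γh : Subgroup SU11) : Function.Surjective (toSpin Γh) :=
  Quotient.mk_surjective

/-- Every spin frame is a `Spin4` translate of a point of the section, so an equivariant map is
determined along the section. -/
lemma exists_boost_mul (g : SU11) : ∃ s : Spin4, g = boost (eta g • e5) * s := by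
  refine ⟨⟨(boost (eta g • e5))⁻¹ * g, ?_⟩, by simp⟩
  change eta _ • e5 = e5
  rw [map_mul, map_inv, mul_smul, inv_smul_eq_iff, eta_boost_smul]

/-- A map of the spin structure that agrees with left multiplication by `A` at one point agrees
with it everywhere. -/
lemma IsSpinSymmetry.eq_mul_left {Γ : Subgroup SO41} {Γh : Subgroup SU11}
    (hΓh : IsSpinLift Γ Γh) {φ : Mfd Γ → Mfd Γ} {φh : SpinBundle Γh ≃ₜ SpinBundle Γh}
    (hφh : IsSpinSymmetry Γ Γh φ φh) {A : SU11} (hA : InducesIsometry Γ (eta A) φ) {x : H4}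
    (hx : φh (toSpin Γh (boost x)) = toSpin Γh (A * boost x)) (g : SU11) :
    φh (toSpin Γh g) = toSpin Γh (A * g) := by
  have := t2Space_spinBundle hΓh.discrete
  have hor : ∀ z : H4, φh (toSpin Γh (boost z)) = toSpin Γh (A * boost z) ∨
      φh (toSpin Γh (boost z)) = toSpin Γh (negOne * (A * boost z)) := by
    intro z
    obtain ⟨h, hh⟩ := toSpin_surjective Γh (φh (toSpin Γh (boost z)))
    have hc := hφh.covers (boost z) h (eta A) (hA.isLocalLift _) hh.symm
    rw [← map_mul] at hc
    rw [← hh]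
    exact hΓh.toSpin_eq_or hc
  set S := {z : H4 | φh (toSpin Γh (boost z)) = toSpin Γh (A * boost z)} with hS
  have hl : Continuous fun z => φh (toSpin Γh (boost z)) :=
    φh.continuous.comp ((continuous_toSpin Γh).comp continuous_boost)
  have hclosed : IsClosed S := isClosed_eq hl
    ((continuous_toSpin Γh).comp (continuous_const.mul continuous_boost))
  -- The complement is where the opposite sign holds, hence closed as well; so `S` is clopen.
  have hcompl : Sᶜ =
      {z : H4 | φh (toSpin Γh (boost z)) = toSpin Γh (negOne * (A * boost z))} := by
    ext z
    constructor
    · exact fun h => (hor z).resolve_left h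
    · intro h h'
      exact hΓh.toSpin_negOne_mul_ne _ (h'.symm.trans h)
  have hopen : IsOpen S := by
    rw [← isClosed_compl_iff, hcompl]
    exact isClosed_eq hl ((continuous_toSpin Γh).comp
      (continuous_const.mul (continuous_const.mul continuous_boost)))
  have huniv : S = Set.univ := IsClopen.eq_univ ⟨hclosed, hopen⟩ ⟨x, hx⟩
  obtain ⟨s, hs⟩ := exists_boost_mul g
  have hz : φh (toSpin Γh (boost (eta g • e5))) = toSpin Γh (A * boost (eta g • e5)) :=
    (Set.ext_iff.mp huniv _).mpr (Set.mem_univ _)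
  have := hφh.equivariant _ _ s hz
  rwa [mul_assoc, ← hs] at this

/-- Membership of γ in Γ̂ says that γ and 1 have the same coset; as φ̂ is injective, this can be
tested after multiplication by A. -/
lemma inducesSymmetry_of_eq {Γh : Subgroup SU11} {φh : SpinBundle Γh ≃ₜ SpinBundle Γh}
    {A : SU11} (h : ∀ g, φh (toSpin Γh g) = toSpin Γh (A * g)) : InducesSymmetry Γh A φh := by
  have key : ∀ γ, γ ∈ Γh ↔ toSpin Γh γ = toSpin Γh 1 := fun γ => by
    rw [toSpin_eq_iff]
    simp
  refine ⟨Subgroup.mem_normalizer_iff.mpr fun γ => ?_, h⟩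
  have h1 : toSpin Γh γ = toSpin Γh 1 ↔ toSpin Γh (A * γ) = toSpin Γh A := by
    rw [← φh.injective.eq_iff, h, h, mul_one]
  rw [key, h1, toSpin_eq_iff]
  constructor
  · rintro ⟨δ, hδ, e⟩
    rw [← e]; simpa using hδ
  · intro hγ
    exact ⟨_, hγ, by simp⟩

/-- A representative h of the image of one spin frame covers the image frame up to some γ in Γ.
Lifting γ to Γ̂ and correcting h by it yields an element over Φ that already has the right sign. -/
lemma IsSpinSymmetry.existsUnique_lift {Γ : Subgroup SO41} {Γh : Subgroup SU11}
    (hΓh : IsSpinLift Γ Γh) {φ : Mfd Γ → Mfd Γ} {φh : SpinBundle Γh ≃ₜ SpinBundle Γh}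
    (hφh : IsSpinSymmetry Γ Γh φ φh) {Φ : SO41} (hΦ : InducesIsometry Γ Φ φ) :
    ∃! Φh : SU11, eta Φh = Φ ∧ InducesSymmetry Γh Φh φh := by
  obtain ⟨h, hh⟩ := toSpin_surjective Γh (φh (toSpin Γh (boost e5)))
  have hc := hφh.covers (boost e5) h Φ (hΦ.isLocalLift _) hh.symm
  obtain ⟨γ, hγ, e⟩ := toFrame_eq_iff.mp hc
  obtain ⟨γh, hγh, rfl⟩ := hΓh.exists_lift hγ
  have heta : eta (γh⁻¹ * h * (boost e5)⁻¹) = Φ := by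
    rw [map_mul, map_mul, map_inv, map_inv, ← e]
    group
  refine ⟨γh⁻¹ * h * (boost e5)⁻¹, ⟨heta, ?_⟩, ?_⟩
  · refine inducesSymmetry_of_eq (hφh.eq_mul_left hΓh (x := e5) (by rwa [heta]) ?_)
    rw [← hh, toSpin_eq_iff]
    exact ⟨γh, hγh, by group⟩
  · rintro B ⟨hB, hB'⟩
    have h1 : toSpin Γh (B * boost e5) = toSpin Γh h := by rw [hh, hB'.2]
    obtain ⟨δ, hδ, e'⟩ := toSpin_eq_iff.mp h1
    -- A second lift B differs by an element of Γ̂ whose image under η is 1.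
    have h2 : δ * γh = 1 := by
      refine hΓh.eq_one (Γh.mul_mem hδ hγh) ?_
      have := congrArg eta e'
      rw [map_mul, map_mul, hB, ← e, ← mul_assoc] at this
      rw [map_mul]
      exact mul_eq_right.mp this
    rw [inv_eq_of_mul_eq_one_left h2, e']
    group

/-! ## Traces of the half spin representations -/

/-- Elements of Spin(4) fix e₅ and so commute with J, which forces s = diag(p, q). -/
lemma spin4_matH_zero_one (s : Spin4) : matH s.1 0 1 = 0 := by
  have h := congrFun (congrFun (spin4_comm_J s) 0) 1
  simp [J, Matrix.mul_apply, Fin.sum_univ_two, Quaternion.ext_iff] at h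
  obtain ⟨h1, h2, h3, h4⟩ := h
  ext <;> simp <;> linarith

lemma spin4_matH_one_zero (s : Spin4) : matH s.1 1 0 = 0 := by
  have h := congrFun (congrFun (spin4_comm_J s) 1) 0
  simp [J, Matrix.mul_apply, Fin.sum_univ_two, Quaternion.ext_iff] at h
  obtain ⟨h1, h2, h3, h4⟩ := h
  ext <;> simp <;> linarith

lemma spin4_normSq (s : Spin4) :
    Quaternion.normSq (matH s.1 0 0) = 1 ∧ Quaternion.normSq (matH s.1 1 1) = 1 := by
  obtain ⟨h1, h2, -, -⟩ := entries s.1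
  rw [spin4_matH_zero_one s] at h1
  rw [spin4_matH_one_zero s] at h2
  simp at h1 h2
  exact ⟨h1, h2⟩

lemma chirality_apply (w : Spinor) (i : Fin 2) :
    chirality w (0, i) = w (0, i) ∧ chirality w (1, i) = -w (1, i) := by
  rw [chirality_eq, Matrix.toLin'_apply]
  constructor <;> fin_cases i <;>
    simp [Matrix.mulVec, dotProduct, Fintype.sum_prod_type, Fin.sum_univ_two, psi2, psi1, J] <;>
    simp [Complex.ext_iff]

/-- Chirality is Ψ₂(J), which is ±1 on the two blocks. The form `j ≠ 0` matches the common
hypothesis of `halfSpinorEquiv` for both signs. -/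
lemma mem_halfSpinor_one (w : Spinor) : w ∈ HalfSpinor 1 ↔ ∀ j ≠ 0, ∀ i, w (j, i) = 0 := by
  rw [Module.End.mem_eigenspace_iff, one_smul]
  constructor
  · intro h j hj i
    obtain rfl : j = 1 := by omega
    have := (chirality_apply w i).2
    rw [h] at this
    exact self_eq_neg.mp this
  · intro h
    ext ⟨j, i⟩
    fin_cases j
    · exact (chirality_apply w i).1
    · have := (chirality_apply w i).2
      rw [h 1 (by simp) i, neg_zero] at this
      exact this.trans (h 1 (by simp) i).symm

lemma mem_halfSpinor_neg_one (w : Spinor) :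
    w ∈ HalfSpinor (-1) ↔ ∀ j ≠ 1, ∀ i, w (j, i) = 0 := by
  rw [Module.End.mem_eigenspace_iff]
  constructor
  · intro h j hj i
    obtain rfl : j = 0 := by omega
    have := (chirality_apply w i).1
    rw [h] at this
    simp only [Pi.smul_apply, smul_eq_mul, neg_one_mul] at this
    exact self_eq_neg.mp this.symm
  · intro h
    ext ⟨j, i⟩
    simp only [Pi.smul_apply, smul_eq_mul, neg_one_mul]
    fin_cases j
    · have := (chirality_apply w i).1
      rw [h 0 (by simp) i] at this
      exact this.trans (by simp [h 0 (by simp) i])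
    · exact (chirality_apply w i).2

/-- A half spinor space that consists of the spinors supported on the `k`-th block. -/
noncomputable def halfSpinorEquiv (ε : ℂ) (k : Fin 2)
    (h : ∀ w : Spinor, w ∈ HalfSpinor ε ↔ ∀ j ≠ k, ∀ i, w (j, i) = 0) :
    HalfSpinor ε ≃ₗ[ℂ] (Fin 2 → ℂ) where
  toFun w i := w.1 (k, i)
  map_add' _ _ := rfl
  map_smul' _ _ := rfl
  invFun v := ⟨fun p => if p.1 = k then v p.2 else 0, (h _).mpr fun j hj i => by simp [hj]⟩
  left_inv w := by
    ext ⟨j, i⟩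
    by_cases hj : j = k
    · simp [hj]
    · simp [hj, (h _).mp w.2 j hj i]
  right_inv v := by ext i; simp

/-- On the k-th block s acts by Ψ₁ of its k-th diagonal entry, whose trace is a + ā. -/
lemma trace_halfSpinRep (ε : ℂ) (k : Fin 2)
    (h : ∀ w : Spinor, w ∈ HalfSpinor ε ↔ ∀ j ≠ k, ∀ i, w (j, i) = 0) (s : Spin4) :
    LinearMap.trace ℂ _ (halfSpinRep ε s) = ((2 * (matH s.1 k k).re : ℝ) : ℂ) := by
  set e := halfSpinorEquiv ε k h
  have hconj : e.conj (halfSpinRep ε s) = Matrix.toLin' (psi1 (matH s.1 k k)) := by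
    refine LinearMap.ext fun v => funext fun i => ?_
    rw [LinearEquiv.conj_apply_apply]
    change (psi2 (matH s.1) *ᵥ (fun p : Fin 2 × Fin 2 => if p.1 = k then v p.2 else 0)) (k, i) =
      (psi1 (matH s.1 k k) *ᵥ v) i
    simp [Matrix.mulVec, dotProduct, Fintype.sum_prod_type, psi2]
  rw [← LinearMap.trace_conj' _ e, hconj, Matrix.trace_toLin'_eq, Matrix.trace_fin_two]
  simp [psi1, Complex.ext_iff]
  ring

lemma trace_halfSpinRep_sub (s : Spin4) :
    LinearMap.trace ℂ _ (halfSpinRep 1 s) - LinearMap.trace ℂ _ (halfSpinRep (-1) s) =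
      ((2 * ((matH s.1 0 0).re - (matH s.1 1 1).re) : ℝ) : ℂ) := by
  rw [trace_halfSpinRep 1 0 mem_halfSpinor_one, trace_halfSpinRep (-1) 1 mem_halfSpinor_neg_one]
  push_cast
  ring

/-! ## The determinant of `I - dφ` -/

/-- The matrix of left multiplication by a quaternion. -/
def leftMulMat (p : ℍ[ℝ]) : Matrix (Fin 4) (Fin 4) ℝ :=
  !![p.re, -p.imI, -p.imJ, -p.imK; p.imI, p.re, -p.imK, p.imJ;
    p.imJ, p.imK, p.re, -p.imI; p.imK, -p.imJ, p.imI, p.re]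

/-- The matrix of right multiplication by a quaternion. -/
def rightMulMat (q : ℍ[ℝ]) : Matrix (Fin 4) (Fin 4) ℝ :=
  !![q.re, -q.imI, -q.imJ, -q.imK; q.imI, q.re, q.imK, -q.imJ;
    q.imJ, -q.imK, q.re, q.imI; q.imK, q.imJ, -q.imI, q.re]

lemma det_rightMulMat (q : ℍ[ℝ]) : (rightMulMat q).det = Quaternion.normSq q ^ 2 := by
  rw [Quaternion.normSq_def']
  simp [rightMulMat, Matrix.det_succ_row_zero, Fin.sum_univ_succ, Fin.succAbove]
  ring

/-- The determinant of v ↦ vq − pv involves only d = Re p − Re q and the norms of the imaginary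
parts. For unit quaternions |Im|² = 1 − Re², and the expression collapses to 4d². -/
lemma det_rightMulMat_sub (p q : ℍ[ℝ]) (hp : Quaternion.normSq p = 1)
    (hq : Quaternion.normSq q = 1) :
    (rightMulMat q - leftMulMat p).det = 4 * (p.re - q.re) ^ 2 := by
  rw [Quaternion.normSq_def'] at hp hq
  have h : (rightMulMat q - leftMulMat p).det = (p.re - q.re) ^ 4 +
      2 * (p.re - q.re) ^ 2 * ((p.imI ^ 2 + p.imJ ^ 2 + p.imK ^ 2) +
        (q.imI ^ 2 + q.imJ ^ 2 + q.imK ^ 2)) +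
      ((p.imI ^ 2 + p.imJ ^ 2 + p.imK ^ 2) - (q.imI ^ 2 + q.imJ ^ 2 + q.imK ^ 2)) ^ 2 := by
    simp [rightMulMat, leftMulMat, Matrix.det_succ_row_zero, Fin.sum_univ_succ, Fin.succAbove]
    ring
  have h1 : p.imI ^ 2 + p.imJ ^ 2 + p.imK ^ 2 = 1 - p.re ^ 2 := by linarith
  have h2 : q.imI ^ 2 + q.imJ ^ 2 + q.imK ^ 2 = 1 - q.re ^ 2 := by linarith
  rw [h, h1, h2]
  ring

/-- Right multiplication by q has determinant |q|⁴ = 1 and turns v − p v q̄ into vq − pv. -/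
lemma det_one_sub_mul (p q : ℍ[ℝ]) (hp : Quaternion.normSq p = 1)
    (hq : Quaternion.normSq q = 1) :
    (1 - leftMulMat p * rightMulMat (star q)).det = 4 * (p.re - q.re) ^ 2 := by
  have hmul : rightMulMat q * (1 - leftMulMat p * rightMulMat (star q)) =
      rightMulMat q - leftMulMat p := by
    have hc : rightMulMat q * leftMulMat p = leftMulMat p * rightMulMat q := by
      ext i j
      fin_cases i <;> fin_cases j <;>
        simp [rightMulMat, leftMulMat, Matrix.mul_apply, Fin.sum_univ_four] <;> ring
    have hq' : rightMulMat q * rightMulMat (star q) = 1 := by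
      rw [Quaternion.normSq_def'] at hq
      ext i j
      fin_cases i <;> fin_cases j <;>
        simp [rightMulMat, Matrix.mul_apply, Fin.sum_univ_four] <;>
        first | ring1 | linear_combination hq
    rw [mul_sub, mul_one, ← mul_assoc, hc, mul_assoc, hq', mul_one]
  rw [← det_rightMulMat_sub p q hp hq, ← hmul, Matrix.det_mul, det_rightMulMat, hq]
  simp

/-- The inclusion of `ℝ⁴` into `ℝ^{4,1}`. -/
def embed4 : (Fin 4 → ℝ) →ₗ[ℝ] (Fin 5 → ℝ) where
  toFun v := ![v 0, v 1, v 2, v 3, 0]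
  map_add' u v := by ext i; fin_cases i <;> simp
  map_smul' r v := by ext i; fin_cases i <;> simp

/-- The projection of `ℝ^{4,1}` to `ℝ⁴`. -/
def proj4 : (Fin 5 → ℝ) →ₗ[ℝ] (Fin 4 → ℝ) where
  toFun u := ![u 0, u 1, u 2, u 3]
  map_add' u v := by ext i; fin_cases i <;> simp
  map_smul' r v := by ext i; fin_cases i <;> simp

lemma proj4_embed4 (v : Fin 4 → ℝ) : proj4 (embed4 v) = v := by
  ext i; fin_cases i <;> simp [proj4, embed4]

lemma embed4_proj4 {u : Fin 5 → ℝ} (h : u 4 = 0) : embed4 (proj4 u) = u := by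
  ext i; fin_cases i <;> simp [proj4, embed4, h]

lemma matR_inv_mulVec (M : SO41) (u : Fin 5 → ℝ) : matR M⁻¹ *ᵥ (matR M *ᵥ u) = u := by
  rw [Matrix.mulVec_mulVec, ← matR_mul, inv_mul_cancel, matR_one, Matrix.one_mulVec]

lemma matR_mulVec_inv (M : SO41) (u : Fin 5 → ℝ) : matR M *ᵥ (matR M⁻¹ *ᵥ u) = u := by
  rw [Matrix.mulVec_mulVec, ← matR_mul, mul_inv_cancel, matR_one, Matrix.one_mulVec]

lemma lor_matR (M : SO41) (u v : Fin 5 → ℝ) : lor (matR M *ᵥ u) (matR M *ᵥ v) = lor u v :=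
  M.2.1 u v

lemma lor_e5 (u : Fin 5 → ℝ) : lor e5.1 u = -u 4 := by simp [lor, e5]

/-- The frame `g e₁, …, g e₄` identifies `ℝ⁴` with the tangent space at `g e₅`. -/
noncomputable def frameEquiv (g : SO41) : (Fin 4 → ℝ) ≃ₗ[ℝ] TangentH (g • e5) where
  toFun v := ⟨matR g *ᵥ embed4 v, by
    change lor (matR g *ᵥ e5.1) (matR g *ᵥ embed4 v) = 0
    rw [lor_matR, lor_e5]
    simp [embed4]⟩
  map_add' u v := Subtype.ext (by simp [Matrix.mulVec_add])
  map_smul' r v := Subtype.ext (by simp [Matrix.mulVec_smul])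
  invFun u := proj4 (matR g⁻¹ *ᵥ u.1)
  left_inv v := by simp only [matR_inv_mulVec, proj4_embed4]
  right_inv u := Subtype.ext (by
    have h : (matR g⁻¹ *ᵥ u.1) 4 = 0 := by
      have h1 : lor (matR g *ᵥ e5.1) u.1 = 0 := u.2
      rw [← matR_mulVec_inv g u.1, lor_matR, lor_e5] at h1
      exact neg_eq_zero.mp h1
    simp only [embed4_proj4 h, matR_mulVec_inv])

lemma frameEquiv_val (g : SO41) (v : Fin 4 → ℝ) :
    (frameEquiv g v).1 = matR g *ᵥ embed4 v := rfl

/-- For s = diag(p, q) the upper right entry of s c(v) s⁻¹ is p v q̄. -/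
lemma matR_eta_embed4 (s : Spin4) (v : Fin 4 → ℝ) :
    matR (eta s.1) *ᵥ embed4 v =
      embed4 ((leftMulMat (matH s.1 0 0) * rightMulMat (star (matH s.1 1 1))) *ᵥ v) := by
  refine cliff_injective ?_
  rw [cliff_eta, matH_inv_eq]
  have h01 := spin4_matH_zero_one s
  have h10 := spin4_matH_one_zero s
  rw [← Matrix.mulVec_mulVec]
  ext i j <;> fin_cases i <;> fin_cases j <;>
    simp [cliff, embed4, h01, h10, Matrix.mul_apply, Fin.sum_univ_two, leftMulMat, rightMulMat,
      dotProduct, Fin.sum_univ_four] <;> ring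

/-- The determinant of `I - L`, where `L` is the action on `T_y H⁴` of an isometry that fixes `y`,
in terms of the rotation `s` of a frame at `y`. -/
lemma det_id_sub_of_frame {g : SO41} {y : H4} (hg : g • e5 = y)
    (L : TangentH y →ₗ[ℝ] TangentH y) (A : SO41) (hL : ∀ v, (L v).1 = matR A *ᵥ v.1)
    (s : Spin4) (hs : A * g = g * eta s.1) :
    LinearMap.det (LinearMap.id - L) = 4 * ((matH s.1 0 0).re - (matH s.1 1 1).re) ^ 2 := by
  subst hg
  obtain ⟨hp, hq⟩ := spin4_normSq s
  set N := leftMulMat (matH s.1 0 0) * rightMulMat (star (matH s.1 1 1)) with hN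
  have hconj : ((frameEquiv g : (Fin 4 → ℝ) →ₗ[ℝ] _) ∘ₗ Matrix.toLin' (1 - N)) ∘ₗ
      ((frameEquiv g).symm : _ →ₗ[ℝ] (Fin 4 → ℝ)) = LinearMap.id - L := by
    refine LinearMap.ext fun u => ?_
    obtain ⟨v, rfl⟩ := (frameEquiv g).surjective u
    simp only [LinearMap.comp_apply, LinearEquiv.coe_coe, LinearEquiv.symm_apply_apply,
      LinearMap.sub_apply, LinearMap.id_apply]
    refine Subtype.ext ?_
    rw [Submodule.coe_sub, hL, frameEquiv_val, frameEquiv_val, Matrix.mulVec_mulVec, ← matR_mul,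
      hs, matR_mul, ← Matrix.mulVec_mulVec, matR_eta_embed4, ← hN, ← Matrix.mulVec_sub, ← map_sub,
      Matrix.toLin'_apply, Matrix.sub_mulVec, Matrix.one_mulVec]
  rw [← hconj, LinearMap.comp_assoc, LinearMap.det_conj, LinearMap.det_toLin',
    det_one_sub_mul _ _ hp hq]

lemma etaVec_e5_four_eq (A : SU11) : etaVec A e5.1 4 =
    Quaternion.normSq (matH A 1 0) + Quaternion.normSq (matH A 1 1) := by
  rw [Quaternion.normSq_def', Quaternion.normSq_def']
  simp [etaVec, coord, matH_inv_eq, cliff, e5, Matrix.mul_apply, Fin.sum_univ_two]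
  ring

/-- The real part of the supertrace of a conjugate of an element of `Spin(4)`. -/
lemma re_sub_re_conj (g : SU11) (s : Spin4) {x : H4} (hx : eta g • e5 = x) :
    (matH (g * s.1 * g⁻¹) 0 0).re - (matH (g * s.1 * g⁻¹) 1 1).re =
      x.1 4 * ((matH s.1 0 0).re - (matH s.1 1 1).re) := by
  have hx4 : x.1 4 = etaVec g e5.1 4 := by
    rw [← hx, ← etaMat_mulVec]; rfl
  obtain ⟨e1, e2, e3, -⟩ := entries g
  rw [hx4, etaVec_e5_four_eq]
  have h00 : (matH (g * s.1 * g⁻¹) 0 0).re = Quaternion.normSq (matH g 0 0) * (matH s.1 0 0).re -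
      Quaternion.normSq (matH g 0 1) * (matH s.1 1 1).re := by
    rw [matH_mul, matH_mul, matH_inv_eq, Quaternion.normSq_def', Quaternion.normSq_def']
    simp [Matrix.mul_apply, Fin.sum_univ_two, spin4_matH_zero_one s, spin4_matH_one_zero s]
    ring
  have h11 : (matH (g * s.1 * g⁻¹) 1 1).re = Quaternion.normSq (matH g 1 1) * (matH s.1 1 1).re -
      Quaternion.normSq (matH g 1 0) * (matH s.1 0 0).re := by
    rw [matH_mul, matH_mul, matH_inv_eq, Quaternion.normSq_def', Quaternion.normSq_def']
    simp [Matrix.mul_apply, Fin.sum_univ_two, spin4_matH_zero_one s, spin4_matH_one_zero s]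
    ring
  -- For g with rows (a, b) and (c, d) one has |b| = |c| and |a| = |d|, so the difference is (|c|² +
  -- |d|²)(Re p − Re q), and |c|² + |d|² = x₅.
  have f1 : Quaternion.normSq (matH g 0 1) = Quaternion.normSq (matH g 1 0) := by linarith
  have f2 : Quaternion.normSq (matH g 0 0) = Quaternion.normSq (matH g 1 1) := by linarith
  rw [h00, h11, f1, f2]
  ring

/-! ## Isolated fixed points -/

lemma continuous_toMfd (Γ : Subgroup SO41) : Continuous (toMfd Γ) := continuous_quotient_mk'

/-- The isometry that fixes a point over an isolated fixed point fixes no tangent vector there. -/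
lemma IsIsolatedFixedPoint.eq_zero_of_fixed {Γ : Subgroup SO41} [Countable Γ]
    {φ : Mfd Γ → Mfd Γ} {x : H4} (hP : IsIsolatedFixedPoint Γ φ (toMfd Γ x)) {Φ : SO41}
    (hΦ : InducesIsometry Γ Φ φ) (hx : Φ • x = x) (v : TangentH x)
    (hv : matR Φ *ᵥ v.1 = v.1) : v = 0 := by
  by_contra hne
  have hne' : v.1 ≠ 0 := fun h => hne (Subtype.ext h)
  have h1 : ∀ᶠ w in 𝓝 x, toMfd Γ w ≠ toMfd Γ x → φ (toMfd Γ w) ≠ toMfd Γ w :=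
    (continuous_toMfd Γ).continuousAt.eventually (eventually_nhdsWithin_iff.mp hP.2)
  have hc : Tendsto (fun t : ℝ => x.1 + t • v.1) (𝓝 0) (𝓝 x.1) := by
    have : Continuous (fun t : ℝ => x.1 + t • v.1) := by fun_prop
    simpa using this.tendsto 0
  have h2 := hc.eventually (eventually_cone x h1)
  -- The rescaled points of the line x + tv are fixed, so by isolation they lie in the orbit Γx.
  -- Each orbit point accounts for at most one t, so a neighbourhood of 0 in ℝ would be countable.
  have h3 : ∀ᶠ t in 𝓝 (0 : ℝ), t ∈ ⋃ γ : Γ, {t : ℝ | ∃ r : ℝ, 0 < r ∧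
      (γ.1 • x).1 = r • (x.1 + t • v.1)} := by
    filter_upwards [h2] with t ht
    obtain ⟨w, r, hr, hw, hwt⟩ := ht
    have hfix : Φ • w = w := Subtype.ext (by
      have hx' : matR Φ *ᵥ x.1 = x.1 := congrArg Subtype.val hx
      rw [smul_val, hwt, Matrix.mulVec_smul, Matrix.mulVec_add, Matrix.mulVec_smul, hv, hx'])
    have heq : toMfd Γ w = toMfd Γ x := by
      by_contra hn
      exact hw hn (by rw [hΦ.2, hfix])
    obtain ⟨γ, hγ, e⟩ := toMfd_eq_iff.mp heq
    exact Set.mem_iUnion.mpr ⟨⟨γ, hγ⟩, r, hr, by rw [e, hwt]⟩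
  refine (MeasureTheory.Measure.measure_pos_of_mem_nhds
    (MeasureTheory.volume : MeasureTheory.Measure ℝ) h3).ne'
      (Set.Countable.measure_zero (Set.countable_iUnion fun γ => ?_) _)
  refine Set.Subsingleton.countable ?_
  rintro t ⟨r, hr, e⟩ t' ⟨r', hr', e'⟩
  rw [e] at e'
  have hvx : lor x.1 v.1 = 0 := v.2
  have hl : ∀ r t : ℝ, lor x.1 (r • (x.1 + t • v.1)) = -r := by
    intro r t
    have hxx := x.2.1
    simp only [lor, Pi.smul_apply, Pi.add_apply, smul_eq_mul] at hvx hxx ⊢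
    linear_combination r * hxx + r * t * hvx
  -- Pairing with x recovers the scaling factor, since v is orthogonal to x.
  have hrr : r = r' := by
    have := congrArg (lor x.1) e'
    rw [hl, hl] at this
    exact neg_injective this
  subst hrr
  have h4 := add_left_cancel (smul_right_injective _ hr.ne' e')
  exact smul_left_injective ℝ hne' h4

/-! ### Independence of the choices in the contribution -/

/-- The action on `T_y H⁴` of an isometry that fixes `y`. -/
noncomputable def tangentMap (A : SO41) {y : H4} (h : A • y = y) : TangentH y →ₗ[ℝ] TangentH y :=
  (Matrix.mulVecLin (matR A)).restrict fun v hv => by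
    have h' : matR A *ᵥ y.1 = y.1 := congrArg Subtype.val h
    change lor y.1 (matR A *ᵥ v) = 0
    rw [← h', lor_matR]
    exact hv

lemma tangentMap_val (A : SO41) {y : H4} (h : A • y = y) (v : TangentH y) :
    (tangentMap A h v).1 = matR A *ᵥ v.1 := rfl

/-- A spin frame over `Γx` has a representative at `x`, with respect to which the rotation by `φ̂`
is the conjugate of `Φ̂`. -/
lemma exists_frame_conj {Γ : Subgroup SO41} {Γh : Subgroup SU11} (hΓ : IsClosedHyperbolic Γ)
    (hΓh : IsSpinLift Γ Γh) {φh : SpinBundle Γh ≃ₜ SpinBundle Γh} {x : H4} {Φh : SU11}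
    (hΦh : InducesSymmetry Γh Φh φh) (hx : eta Φh • x = x) {g : SU11} {s : Spin4}
    (hg : toMfd Γ (eta g • e5) = toMfd Γ x) (hs : φh (toSpin Γh g) = toSpin Γh (g * s)) :
    ∃ g' : SU11, eta g' • e5 = x ∧ Φh * g' = g' * s.1 := by
  obtain ⟨δ, hδ, hδx⟩ := toMfd_eq_iff.mp hg
  obtain ⟨δh, hδh, rfl⟩ := hΓh.exists_lift hδ
  have hx' : eta (δh⁻¹ * g) • e5 = x := by
    rw [map_mul, map_inv, mul_smul, inv_smul_eq_iff, hδx]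
  have h1 : toSpin Γh (δh⁻¹ * g) = toSpin Γh g :=
    toSpin_eq_iff.mpr ⟨_, Γh.inv_mem hδh, rfl⟩
  have h2 : toSpin Γh (δh⁻¹ * g * s.1) = toSpin Γh (g * s.1) :=
    toSpin_eq_iff.mpr ⟨_, Γh.inv_mem hδh, by rw [mul_assoc]⟩
  rw [← h1, hΦh.2, ← h2] at hs
  obtain ⟨γ, hγ, e⟩ := toSpin_eq_iff.mp hs
  refine ⟨δh⁻¹ * g, hx', ?_⟩
  have hse : eta s.1 • e5 = e5 := s.2
  -- Applied to e₅, the relation says that η(γ) fixes x, so freeness removes γ.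
  have h3 := congrArg (fun a => eta a • e5) e
  simp only [map_mul, mul_smul] at h3
  rw [hse, ← mul_smul (eta δh⁻¹), ← map_mul, hx', hx] at h3
  rw [← e, hΓh.eq_one hγ (hΓ.free (hΓh.eta_mem hγ) h3), one_mul]

/-- A local lift of `φ` that fixes a point over `Γx` is conjugate to the lift `Φ` that fixes
`x`. -/
lemma exists_conj_of_isLocalLift {Γ : Subgroup SO41} [Countable Γ] (hΓ : IsClosedHyperbolic Γ)
    {φ : Mfd Γ → Mfd Γ} {x y : H4} {Φ A : SO41} (hΦ : InducesIsometry Γ Φ φ) (hx : Φ • x = x)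
    (hxy : toMfd Γ y = toMfd Γ x) (hAy : A • y = y) (hA : IsLocalLift Γ φ A y) :
    ∃ δ ∈ Γ, δ • x = y ∧ A * δ = δ * Φ := by
  obtain ⟨δ, hδ, rfl⟩ := toMfd_eq_iff.mp hxy
  obtain ⟨γ, hγ, rfl⟩ := exists_eq_mul_of_eventually (Γ := Γ) (A := A) (B := Φ) (z := δ • x) (by
    filter_upwards [hA] with w hw
    rw [← hw, hΦ.2])
  refine ⟨δ, hδ, rfl, ?_⟩
  have hx' : Φ⁻¹ • x = x := by rw [inv_smul_eq_iff, hx]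
  -- This element lies in Γ because Φ normalizes Γ, and it fixes x because γΦ fixes δx; freeness
  -- makes it trivial.
  have hmem : δ⁻¹ * γ * (Φ * δ * Φ⁻¹) ∈ Γ :=
    Γ.mul_mem (Γ.mul_mem (Γ.inv_mem hδ) hγ) ((Subgroup.mem_normalizer_iff.mp hΦ.1 δ).mp hδ)
  have h1 : δ⁻¹ * γ * (Φ * δ * Φ⁻¹) = 1 := hΓ.free hmem (x := x) (by
    simp only [mul_smul] at hAy ⊢
    rw [hx', hAy, inv_smul_smul])
  have h2 : γ * Φ * δ = δ * (δ⁻¹ * γ * (Φ * δ * Φ⁻¹)) * Φ := by group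
  rw [h2, h1, mul_one]

/-- The frame and the differential may be chosen over different points of the orbit. Elements of Γ̂
and Γ carry them to x, and the rotation s is unchanged. -/
lemma IsFixedPointContribution.eq_div {Γ : Subgroup SO41} {Γh : Subgroup SU11} [Countable Γ]
    (hΓ : IsClosedHyperbolic Γ) (hΓh : IsSpinLift Γ Γh) {φ : Mfd Γ → Mfd Γ}
    {φh : SpinBundle Γh ≃ₜ SpinBundle Γh} {x : H4} {Φh : SU11}
    (hΦ : InducesIsometry Γ (eta Φh) φ) (hΦh : InducesSymmetry Γh Φh φh) (hx : eta Φh • x = x)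
    {ν : ℂ} (hν : IsFixedPointContribution Γ Γh φ φh (toMfd Γ x) ν) :
    ∃ (g : SU11) (s : Spin4), eta g • e5 = x ∧ Φh * g = g * s.1 ∧
      ν = ((2 * ((matH s.1 0 0).re - (matH s.1 1 1).re) : ℝ) : ℂ) /
        ((4 * ((matH s.1 0 0).re - (matH s.1 1 1).re) ^ 2 : ℝ) : ℂ) := by
  obtain ⟨g, s, y, L, hg, hs, hy, ⟨A, hAy, hA, hL⟩, rfl⟩ := hν
  obtain ⟨g', hg', hgs⟩ := exists_frame_conj hΓ hΓh hΦh hx hg hs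
  refine ⟨g', s, hg', hgs, ?_⟩
  obtain ⟨δ, -, hδx, hδ⟩ := exists_conj_of_isLocalLift hΓ hΦ hx hy hAy hA
  -- The frame δη(g′) at y is rotated by A through the same s as g′ is by Φ̂.
  rw [trace_halfSpinRep_sub, det_id_sub_of_frame (g := δ * eta g') (by rw [mul_smul, hg', hδx])
    L A hL s, abs_of_nonneg (by positivity)]
  rw [← mul_assoc, hδ, mul_assoc, ← map_mul, hgs, map_mul, mul_assoc]

lemma isFixedPointContribution_of_frame {Γ : Subgroup SO41} {Γh : Subgroup SU11}
    {φ : Mfd Γ → Mfd Γ} {φh : SpinBundle Γh ≃ₜ SpinBundle Γh} {x : H4} {Φh : SU11}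
    (hΦ : InducesIsometry Γ (eta Φh) φ) (hΦh : InducesSymmetry Γh Φh φh) (hx : eta Φh • x = x)
    {g : SU11} {s : Spin4} (hg : eta g • e5 = x) (hs : Φh * g = g * s.1) :
    IsFixedPointContribution Γ Γh φ φh (toMfd Γ x)
      (((2 * ((matH s.1 0 0).re - (matH s.1 1 1).re) : ℝ) : ℂ) /
        ((4 * ((matH s.1 0 0).re - (matH s.1 1 1).re) ^ 2 : ℝ) : ℂ)) := by
  refine ⟨g, s, x, tangentMap (eta Φh) hx, by rw [hg], by rw [hΦh.2, hs], rfl,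
    ⟨eta Φh, hx, hΦ.isLocalLift x, tangentMap_val _ hx⟩, ?_⟩
  rw [trace_halfSpinRep_sub, det_id_sub_of_frame hg _ (eta Φh) (tangentMap_val _ hx) s
    (by rw [← map_mul, hs, map_mul]), abs_of_nonneg (by positivity)]

/-- At an isolated fixed point the difference of the half spin characters does not vanish. -/
lemma re_sub_re_ne_zero_of_isolated {Γ : Subgroup SO41} [Countable Γ] {φ : Mfd Γ → Mfd Γ} {x : H4}
    (hP : IsIsolatedFixedPoint Γ φ (toMfd Γ x)) {Φ : SO41} (hΦ : InducesIsometry Γ Φ φ)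
    (hx : Φ • x = x) {g : SO41} {s : Spin4} (hg : g • e5 = x) (hs : Φ * g = g * eta s.1) :
    (matH s.1 0 0).re - (matH s.1 1 1).re ≠ 0 := by
  intro h0
  have hdet := det_id_sub_of_frame hg (tangentMap Φ hx) Φ (tangentMap_val Φ hx) s hs
  rw [h0] at hdet
  obtain ⟨v, hv, hv0⟩ := Submodule.exists_mem_ne_zero_of_ne_bot
    (LinearMap.bot_lt_ker_of_det_eq_zero (hdet.trans (by norm_num))).ne'
  refine hv0 (hP.eq_zero_of_fixed hΦ hx v ?_)
  rw [LinearMap.mem_ker, LinearMap.sub_apply, LinearMap.id_apply, sub_eq_zero] at hv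
  rw [← tangentMap_val Φ hx, ← hv]

lemma exists_spin4_conj {Φh : SU11} {x : H4} (hx : eta Φh • x = x) {g : SU11}
    (hg : eta g • e5 = x) : ∃ s : Spin4, Φh * g = g * s.1 := by
  refine ⟨⟨g⁻¹ * Φh * g, ?_⟩, by group⟩
  change eta _ • e5 = e5
  rw [map_mul, map_mul, map_inv, mul_smul, mul_smul, hg, hx, inv_smul_eq_iff, hg]

/-- Two such lifts differ by an element of Γ that fixes x, and Γ acts freely. -/
lemma InducesIsometry.eq_of_fixed {Γ : Subgroup SO41} [Countable Γ] (hΓ : IsClosedHyperbolic Γ)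
    {φ : Mfd Γ → Mfd Γ} {Φ Φ' : SO41} (h : InducesIsometry Γ Φ φ) (h' : InducesIsometry Γ Φ' φ)
    {x : H4} (hx : Φ • x = x) (hx' : Φ' • x = x) : Φ = Φ' := by
  obtain ⟨γ, hγ, rfl⟩ := exists_eq_mul_of_eventually (Γ := Γ) (A := Φ) (B := Φ') (z := x)
    (Eventually.of_forall fun w => by rw [← h.2, ← h'.2])
  rw [mul_smul, hx'] at hx
  rw [hΓ.free hγ hx, one_mul]

end HypSpin

theorem theorem7p5
    (Γ : Subgroup HypSpin.SO41) (Γh : Subgroup HypSpin.SU11)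
    (hΓ : HypSpin.IsClosedHyperbolic Γ) (hΓh : HypSpin.IsSpinLift Γ Γh)
    (φ : HypSpin.Mfd Γ → HypSpin.Mfd Γ) (hφ : HypSpin.IsOrientedIsometry Γ φ)
    (φh : HypSpin.SpinBundle Γh ≃ₜ HypSpin.SpinBundle Γh)
    (hφh : HypSpin.IsSpinSymmetry Γ Γh φ φh)
    (P : HypSpin.Mfd Γ) (hP : HypSpin.IsIsolatedFixedPoint Γ φ P)
    (x : HypSpin.H4) (hx : HypSpin.toMfd Γ x = P) :
    (∃! Φ : HypSpin.SO41, HypSpin.InducesIsometry Γ Φ φ ∧ Φ • x = x) ∧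
    ∀ Φ : HypSpin.SO41, HypSpin.InducesIsometry Γ Φ φ → Φ • x = x →
      (∃! Φh : HypSpin.SU11, HypSpin.eta Φh = Φ ∧ HypSpin.InducesSymmetry Γh Φh φh) ∧
      ∀ Φh : HypSpin.SU11, HypSpin.eta Φh = Φ → HypSpin.InducesSymmetry Γh Φh φh →
        (HypSpin.matH Φh 0 0).re - (HypSpin.matH Φh 1 1).re ≠ 0 ∧
        ∀ ν : ℂ, HypSpin.IsFixedPointContribution Γ Γh φ φh P ν ↔
          ν = ((x.1 4 / (2 * ((HypSpin.matH Φh 0 0).re - (HypSpin.matH Φh 1 1).re)) : ℝ) : ℂ) := by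
  subst hx
  have := HypSpin.countable_of_discrete Γ hΓ.discrete
  refine ⟨?_, fun Φ hΦ hΦx => ⟨hφh.existsUnique_lift hΓh hΦ, ?_⟩⟩
  · obtain ⟨Φ, hΦ, hΦx⟩ := hφ.exists_lift_fixing hP.1
    exact ⟨Φ, ⟨hΦ, hΦx⟩, fun Φ' h' => h'.1.eq_of_fixed hΓ hΦ h'.2 hΦx⟩
  rintro Φh rfl hΦh
  have hx4 : x.1 4 ≠ 0 := x.2.2.ne'
  have key : ∀ (g : HypSpin.SU11) (s : HypSpin.Spin4), HypSpin.eta g • HypSpin.e5 = x →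
      Φh * g = g * s.1 →
      (HypSpin.matH s.1 0 0).re - (HypSpin.matH s.1 1 1).re ≠ 0 ∧
      (HypSpin.matH Φh 0 0).re - (HypSpin.matH Φh 1 1).re =
        x.1 4 * ((HypSpin.matH s.1 0 0).re - (HypSpin.matH s.1 1 1).re) := by
    intro g s hg hs
    refine ⟨HypSpin.re_sub_re_ne_zero_of_isolated hP hΦ hΦx hg (by rw [← map_mul, hs, map_mul]), ?_⟩
    rw [← HypSpin.re_sub_re_conj g s hg, ← hs, mul_inv_cancel_right]
  -- With d = Re p − Re q the quotient is 2d/(4d²) = 1/(2d), and d is the corresponding difference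
  -- for Φ̂ divided by x₅.
  have value : ∀ (g : HypSpin.SU11) (s : HypSpin.Spin4), HypSpin.eta g • HypSpin.e5 = x →
      Φh * g = g * s.1 →
      ((2 * ((HypSpin.matH s.1 0 0).re - (HypSpin.matH s.1 1 1).re) : ℝ) : ℂ) /
        ((4 * ((HypSpin.matH s.1 0 0).re - (HypSpin.matH s.1 1 1).re) ^ 2 : ℝ) : ℂ) =
      ((x.1 4 / (2 * ((HypSpin.matH Φh 0 0).re - (HypSpin.matH Φh 1 1).re)) : ℝ) : ℂ) := by
    intro g s hg hs
    obtain ⟨hd, he⟩ := key g s hg hs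
    rw [he, ← Complex.ofReal_div]
    congr 1
    field_simp
    norm_num
  -- The boost supplies one frame at x; it gives the nonvanishing and shows that the value is
  -- attained.
  have hb := HypSpin.eta_boost_smul x
  obtain ⟨s, hs⟩ := HypSpin.exists_spin4_conj hΦx hb
  obtain ⟨hd, he⟩ := key _ s hb hs
  refine ⟨he ▸ mul_ne_zero hx4 hd, fun ν => ⟨fun hν => ?_, fun hν => ?_⟩⟩
  · obtain ⟨g, s', hg, hs', rfl⟩ := hν.eq_div hΓ hΓh hΦ hΦh hΦx
    exact value g s' hg hs'
  · rw [hν, ← value _ s hb hs]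
    exact HypSpin.isFixedPointContribution_of_frame hΦ hΦh hΦx hb hs
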